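/- **Setting and notation.** Let $n,m\ge 1$; functions on $\mathbb R^n$ are scalar valued (real or complex) and $B(x,r)$ denotes the open ball; $\lambda B$ is the ball concentric with $B$ with $\lambda$ times its radius. A weight is a nonnegative locally integrable function on $\mathbb R^n$ that is positive a.e., and $\omega(E)=\int_E\omega\,dx$. Let $1<p_k<\infty$ $(k=1,\dots,m)$ and $\frac1p=\sum_{k=1}^m\frac1{p_k}$. For a weight $\omega$, an exponent $0<q<\infty$ and a positive measurable function $\varphi$ on $\mathbb R^n\times(0,\infty)$ let $M^{q,\varphi}(\omega)$ be the space of measurable $f$ with $$\|f\|_{M^{q,\varphi}(\omega)}=\sup_{x\in\mathbb R^n,\,r>0}\varphi(x,r)^{-1}\,\omega(B(x,r))^{-1/q}\Big(\int_{B(x,r)}|f|^q\,\omega\,dx\Big)^{1/q}<\infty .$$ Let $A_q$ $(1\le q<\infty)$ be the Muckenhoupt classes and $A_\infty=\bigcup_{1\le q<\infty}A_q$. Let $v\in A_\infty$, and let $\omega_1,\dots,\omega_m\in A_\infty$ be such that $\vec\omega\in A_{\vec P}$, that is, with $p_i'=p_i/(p_i-1)$, $$\sup_B\Big(\frac1{|B|}\int_B\prod_{i=1}^m\omega_i^{p/p_i}\,dx\Big)^{1/p}\prod_{i=1}^m\Big(\frac1{|B|}\int_B\omega_i^{1-p_i'}\,dx\Big)^{1/p_i'}<\infty,$$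 the supremum being over all balls. Let $\varphi_{11},\dots,\varphi_{1m},\varphi_2$ be positive measurable functions on $\mathbb R^n\times(0,\infty)$ with $$\sup_{x\in\mathbb R^n,\,r>0}\varphi_2(x,r)^{-1}\int_r^\infty\Big(1+\log\frac tr\Big)^m\,\frac{\operatorname*{ess\,inf}_{t<\eta<\infty}\prod_{i=1}^m\varphi_{1i}(x,\eta)\,\omega_i(B(x,\eta))^{1/p_i}}{\prod_{i=1}^m\omega_i(B(x,t))^{1/p_i}}\,\frac{dt}t<\infty .$$ Put $X_i=M^{p_i,\varphi_{1i}}(\omega_i)$ and $Y=M^{p,\varphi_2}(v)$. An $m$-sublinear operator on a product $\prod_iD_i$ of linear spaces of functions is a map $S$ from $\prod_i D_i$ to measurable functions such that, pointwise and in each slot $i$, $$|S(\dots,f_i+g_i,\dots)|\le|S(\dots,f_i,\dots)|+|S(\dots,g_i,\dots)|,\qquad |S(\dots,cf_i,\dots)|=|c|\,|S(\dots,f_i,\dots)|$$ for every scalar $c$. For an operator $S$ on $\prod_iX_i$ we write * $S\in B(\prod X_i\to Y)$ if $S$ is $m$-sublinear on $\prod_i X_i$ and there is $C$ with $\|S(\vec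 f)\|_Y\le C\prod_i\|f_i\|_{X_i}$ for all $\vec f\in\prod_iX_i$; * $S\in LB(\prod X_i\to Y)$ if $S$ is $m$-sublinear on $\prod_iX_i$ and there is $C$ with $\|S(f_1\chi_{2B},\dots,f_m\chi_{2B})\|_Y\le C\prod_i\|f_i\|_{X_i}$ for all balls $B$ and all $\vec f\in\prod_iX_i$. **Statement.** Let $\vec b=(b_1,\dots,b_m)\in BMO^m$ and put $D_i=X_i+b_iX_i=\{f+b_ig: f,g\in X_i\}$. Let $T$ be an $m$-sublinear operator on $\prod_iD_i$ for which there is a constant $C$ with $$|T(\vec f)(x)|\le C\int_{(\mathbb R^n)^m}\frac{\prod_{i=1}^m|f_i(y_i)|}{\big(\sum_{j=1}^m|x-y_j|\big)^{mn}}\,d\vec y\qquad\text{for all }\vec f\in\prod_iD_i,\ x\notin\bigcap_{j=1}^m\operatorname{supp}f_j .$$ Define, for $\vec f\in\prod_iX_i$, $$T_{\prod\vec b}(\vec f)(x)=T\big((b_1(x)-b_1)f_1,\dots,(b_m(x)-b_m)f_m\big)(x),\qquad T_{\sum\vec b}(\vec f)(x)=\sum_{j=1}^mT\big(f_1,\dots,(b_j(x)-b_j)f_j,\dots,f_m\big)(x).$$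 Then $$T_{\prod\vec b}\in LB\Big(\prod X_i\to Y\Big)\iff T_{\prod\vec b}\in B\Big(\prod X_i\to Y\Big),$$ $$T_{\sum\vec b}\in LB\Big(\prod X_i\to Y\Big)\iff T_{\sum\vec b}\in B\Big(\prod X_i\to Y\Big).$$ -/

import Mathlib

open MeasureTheory
open scoped ENNReal NNReal

/-- The Euclidean space of dimension `n`. -/
abbrev Rn (n : ℕ) : Type := EuclideanSpace ℝ (Fin n)

noncomputable section

/-! ### Weights -/

/-- The average of a nonnegative function over the ball `B(x, r)`. -/
def ballAvg {n : ℕ} (x : Rn n) (r : ℝ) (f : Rn n → ℝ≥0∞) : ℝ≥0∞ :=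
  (∫⁻ y in Metric.ball x r, f y) / volume (Metric.ball x r)

/-- A weight: a nonnegative locally integrable function that is positive almost everywhere. -/
structure IsWeight {n : ℕ} (ω : Rn n → ℝ) : Prop where
  nonneg : ∀ x, 0 ≤ ω x
  locallyIntegrable : LocallyIntegrable ω volume
  pos_ae : ∀ᵐ x, 0 < ω x

/-- The weighted measure `ω(E) = ∫_E ω(x) dx`. -/
def wMeas {n : ℕ} (ω : Rn n → ℝ) (s : Set (Rn n)) : ℝ≥0∞ :=
  ∫⁻ x in s, ENNReal.ofReal (ω x)

/-- The Muckenhoupt class `A_q`, `1 < q < ∞`. -/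
def IsMuckenhoupt {n : ℕ} (q : ℝ) (ω : Rn n → ℝ) : Prop :=
  IsWeight ω ∧ ∃ C : ℝ≥0, ∀ (x : Rn n) (r : ℝ), 0 < r →
    ballAvg x r (fun y => ENNReal.ofReal (ω y)) *
      (ballAvg x r fun y => ENNReal.ofReal (ω y) ^ (-(1 / (q - 1)))) ^ (q - 1) ≤ C

/-- The Muckenhoupt class `A_1`. -/
def IsMuckenhouptOne {n : ℕ} (ω : Rn n → ℝ) : Prop :=
  IsWeight ω ∧ ∃ C : ℝ≥0, ∀ (x : Rn n) (r : ℝ), 0 < r →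
    ballAvg x r (fun y => ENNReal.ofReal (ω y)) ≤
      C * essInf (fun y => ENNReal.ofReal (ω y)) (volume.restrict (Metric.ball x r))

/-- The class `A_∞`, the union of all `A_q`, `1 ≤ q < ∞`. -/
def IsAInfty {n : ℕ} (ω : Rn n → ℝ) : Prop :=
  IsMuckenhouptOne ω ∨ ∃ q : ℝ, 1 < q ∧ IsMuckenhoupt q ω

/-- The multiple weight class `A_P` for exponents `P i ∈ (1, ∞)` and `1 / p = ∑ 1 / P i`.
Here `∏ ω_i ^ (p / P i)` is the weight `v_ω`, and `(P i).conjExponent = P i / (P i - 1)`. -/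
def IsMultipleWeight {n m : ℕ} (P : Fin m → ℝ) (p : ℝ) (ω : Fin m → Rn n → ℝ) : Prop :=
  (∀ i, IsWeight (ω i)) ∧ ∃ C : ℝ≥0, ∀ (x : Rn n) (r : ℝ), 0 < r →
    (ballAvg x r fun y => ENNReal.ofReal (∏ i, ω i y ^ (p / P i))) ^ (1 / p) *
      ∏ i, (ballAvg x r fun y =>
        ENNReal.ofReal (ω i y) ^ (1 - (P i).conjExponent)) ^ (1 / (P i).conjExponent) ≤ C

/-! ### Generalized weighted Morrey spaces -/

/-- A positive measurable function on `ℝⁿ × (0, ∞)`. -/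
structure IsMorreyFunction {n : ℕ} (φ : Rn n → ℝ → ℝ) : Prop where
  pos : ∀ x r, 0 < r → 0 < φ x r
  measurable : Measurable fun q : Rn n × Set.Ioi (0 : ℝ) => φ q.1 q.2

/-- The (quasi)norm of `L^p(E, ω dx)`. -/
def wLpNorm {n : ℕ} {𝕜 : Type*} [RCLike 𝕜] (p : ℝ) (ω : Rn n → ℝ) (s : Set (Rn n))
    (f : Rn n → 𝕜) : ℝ≥0∞ :=
  (∫⁻ x in s, ‖f x‖ₑ ^ p * ENNReal.ofReal (ω x)) ^ (1 / p)

/-- The (quasi)norm of the generalized weighted Morrey space `M^{p,φ}(ω)`. -/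
def morreyNorm {n : ℕ} {𝕜 : Type*} [RCLike 𝕜] (p : ℝ) (φ : Rn n → ℝ → ℝ) (ω : Rn n → ℝ)
    (f : Rn n → 𝕜) : ℝ≥0∞ :=
  ⨆ (x : Rn n) (r : ℝ) (_ : 0 < r),
    (ENNReal.ofReal (φ x r))⁻¹ * wMeas ω (Metric.ball x r) ^ (-(1 / p)) *
      wLpNorm p ω (Metric.ball x r) f

/-- The generalized weighted Morrey space `M^{p,φ}(ω)`, as a set of functions. -/
def morreySpace {n : ℕ} (𝕜 : Type*) [RCLike 𝕜] (p : ℝ) (φ : Rn n → ℝ → ℝ) (ω : Rn n → ℝ) :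
    Set (Rn n → 𝕜) :=
  {f | AEStronglyMeasurable f volume ∧ morreyNorm p φ ω f < ∞}

/-- The constant
`sup_{x, r} φ₂(x,r)⁻¹ ∫_r^∞ (1 + log (t/r))^m
  (essinf_{t<η<∞} ∏ φ₁ᵢ(x,η) ωᵢ(B(x,η))^{1/pᵢ}) / (∏ ωᵢ(B(x,t))^{1/pᵢ}) dt/t`. -/
def morreyPairConst {n m : ℕ} (P : Fin m → ℝ) (ω : Fin m → Rn n → ℝ)
    (φ₁ : Fin m → Rn n → ℝ → ℝ) (φ₂ : Rn n → ℝ → ℝ) : ℝ≥0∞ :=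
  ⨆ (x : Rn n) (r : ℝ) (_ : 0 < r),
    (ENNReal.ofReal (φ₂ x r))⁻¹ *
      ∫⁻ t in Set.Ioi r,
        ENNReal.ofReal (1 + Real.log (t / r)) ^ m *
          (essInf (fun η : ℝ => ∏ i, (ENNReal.ofReal (φ₁ i x η) *
              wMeas (ω i) (Metric.ball x η) ^ (1 / P i))) (volume.restrict (Set.Ioi t)) /
            ∏ i, wMeas (ω i) (Metric.ball x t) ^ (1 / P i)) /
          ENNReal.ofReal t

/-! ### BMO -/

/-- Functions of bounded mean oscillation. -/
def IsBMO {n : ℕ} {𝕜 : Type*} [RCLike 𝕜] (b : Rn n → 𝕜) : Prop :=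
  LocallyIntegrable b volume ∧ ∃ C : ℝ, ∀ (x : Rn n) (r : ℝ), 0 < r →
    (⨍ y in Metric.ball x r, ‖b y - ⨍ z in Metric.ball x r, b z‖) ≤ C

/-! ### Multi-sublinear operators -/

/-- `T` is an `m`-sublinear operator from `∏ D i` to measurable functions. -/
structure IsMSublinear {n m : ℕ} {𝕜 : Type*} [RCLike 𝕜] (D : Fin m → Set (Rn n → 𝕜))
    (T : (Fin m → Rn n → 𝕜) → Rn n → 𝕜) : Prop where
  measurable : ∀ f, (∀ i, f i ∈ D i) → AEStronglyMeasurable (T f) volume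
  add_le : ∀ f, (∀ i, f i ∈ D i) → ∀ i, ∀ g ∈ D i, ∀ x,
    ‖T (Function.update f i (f i + g)) x‖ ≤ ‖T f x‖ + ‖T (Function.update f i g) x‖
  smul_eq : ∀ f, (∀ i, f i ∈ D i) → ∀ i, ∀ (c : 𝕜) (x : Rn n),
    ‖T (Function.update f i (c • f i)) x‖ = ‖c‖ * ‖T f x‖

/-- The size condition
`|T f (x)| ≤ C ∫ ∏ |f_i(y_i)| / (∑ |x - y_j|)^{mn} dy` for `f ∈ ∏ D i`, `x ∉ ⋂ supp f_j`. -/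
def HasSizeBound {n m : ℕ} {𝕜 : Type*} [RCLike 𝕜] (D : Fin m → Set (Rn n → 𝕜))
    (T : (Fin m → Rn n → 𝕜) → Rn n → 𝕜) : Prop :=
  ∃ C : ℝ≥0, ∀ f, (∀ i, f i ∈ D i) → ∀ x, x ∉ ⋂ j, tsupport (f j) →
    ‖T f x‖ₑ ≤ C * ∫⁻ y : Fin m → Rn n,
      (∏ i, ‖f i (y i)‖ₑ) / (∑ j, edist x (y j)) ^ (m * n)

/-- The iterated commutator `T_{∏b}`. -/
def commProd {n m : ℕ} {𝕜 : Type*} [RCLike 𝕜] (b : Fin m → Rn n → 𝕜)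
    (T : (Fin m → Rn n → 𝕜) → Rn n → 𝕜) : (Fin m → Rn n → 𝕜) → Rn n → 𝕜 :=
  fun f x => T (fun i y => (b i x - b i y) * f i y) x

/-- The commutator `T_{∑b}`. -/
def commSum {n m : ℕ} {𝕜 : Type*} [RCLike 𝕜] (b : Fin m → Rn n → 𝕜)
    (T : (Fin m → Rn n → 𝕜) → Rn n → 𝕜) : (Fin m → Rn n → 𝕜) → Rn n → 𝕜 :=
  fun f x => ∑ j, T (Function.update f j (fun y => (b j x - b j y) * f j y)) x

/-- The space `X + bX`. Every function `(c - b) f` with `f ∈ X` and a constant `c` belongs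
to it if `X` is a linear space. -/
def addMulSpace {n : ℕ} {𝕜 : Type*} [RCLike 𝕜] (b : Rn n → 𝕜) (X : Set (Rn n → 𝕜)) :
    Set (Rn n → 𝕜) :=
  {h | ∃ f ∈ X, ∃ g ∈ X, h = fun y => f y + b y * g y}

/-- `S` is a bounded `m`-sublinear operator from `∏ M^{P i, φ₁ i}(ω i)` to `M^{p, φ₂}(v)`. -/
def MorreyBounded {n m : ℕ} {𝕜 : Type*} [RCLike 𝕜] (P : Fin m → ℝ) (φ₁ : Fin m → Rn n → ℝ → ℝ)
    (ω : Fin m → Rn n → ℝ) (p : ℝ) (φ₂ : Rn n → ℝ → ℝ) (v : Rn n → ℝ)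
    (S : (Fin m → Rn n → 𝕜) → Rn n → 𝕜) : Prop :=
  IsMSublinear (fun i => morreySpace 𝕜 (P i) (φ₁ i) (ω i)) S ∧
    ∃ C : ℝ≥0, ∀ f, (∀ i, f i ∈ morreySpace 𝕜 (P i) (φ₁ i) (ω i)) →
      morreyNorm p φ₂ v (S f) ≤ C * ∏ i, morreyNorm (P i) (φ₁ i) (ω i) (f i)

/-- `S` is a locally bounded `m`-sublinear operator from `∏ M^{P i, φ₁ i}(ω i)` to
`M^{p, φ₂}(v)`: the norm of `S(f₁ χ_{2B}, …, f_m χ_{2B})` is at most a constant times the product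
of the norms of the `f_i`, uniformly over all balls `B`. -/
def MorreyLocallyBounded {n m : ℕ} {𝕜 : Type*} [RCLike 𝕜] (P : Fin m → ℝ)
    (φ₁ : Fin m → Rn n → ℝ → ℝ) (ω : Fin m → Rn n → ℝ) (p : ℝ) (φ₂ : Rn n → ℝ → ℝ)
    (v : Rn n → ℝ) (S : (Fin m → Rn n → 𝕜) → Rn n → 𝕜) : Prop :=
  IsMSublinear (fun i => morreySpace 𝕜 (P i) (φ₁ i) (ω i)) S ∧
    ∃ C : ℝ≥0, ∀ (x₀ : Rn n) (r : ℝ), 0 < r →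
      ∀ f : Fin m → Rn n → 𝕜, (∀ i, f i ∈ morreySpace 𝕜 (P i) (φ₁ i) (ω i)) →
        morreyNorm p φ₂ v (S fun i => (Metric.ball x₀ (2 * r)).indicator (f i)) ≤
          C * ∏ i, morreyNorm (P i) (φ₁ i) (ω i) (f i)

end

/-! Bounded implies locally bounded because cutting a function off to a ball does not increase its
Morrey norm. For the converse fix a ball $B=B(x_0,r)$ and $x\in B$. Replacing $f_i$ by
$f_i\chi_{2B}$ one slot at a time, sublinearity bounds $|S(\vec f)(x)|$ by
$|S(f_1\chi_{2B},\dots,f_m\chi_{2B})(x)|$, which local boundedness controls, plus $m$ terms in each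
of which some slot vanishes on $2B$ (`enorm_le_enorm_indicator_add`).

In such a term $x$ lies off the support of that slot, so the size condition applies. Bounding the
kernel by an integral of $t^{-mn-1}$ separates the variables and leaves
$\int_r^\infty\prod_i\int_{B(x_0,t)}(1+|b_i(x)-b_i|)|f_i|\,t^{-mn-1}dt$ (`lintegral_prod_div_le`).
Hölder's inequality splits each inner integral into the $L^{p_i}(\omega_i)$ norm of $f_i$ on
$B(x_0,t)$ and an $L^{p_i'}$ norm of the oscillation of $b_i$ for the dual weight
$\sigma_i=\omega_i^{1-p_i'}$. The latter costs
$(1+\log(t/r))(1+|b_i(x)-(b_i)_B|)\,\sigma_i(B(x_0,t))^{1/p_i'}$. The condition $A_{\vec P}$,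
together with $\omega_i\in A_\infty$, bounds $\prod\sigma_i(B_t)^{1/p_i'}$ by
$|B_t|^m/\prod\omega_i(B_t)^{1/p_i}$, and the local norms, which increase with $t$, are at most the
Morrey norms times the essential infimum. What remains is the integral in the hypothesis on
$\varphi_2$, and the result is $\varphi_2(x_0,r)\prod(1+|b_i(x)-(b_i)_B|)\prod\|f_i\|$
(`exists_enorm_offDiagonal_le`). The product of oscillations is then integrated over $B$ against $v$
(`exists_lintegral_prod_rpow_le`).

Both integrations of oscillations, against $\sigma_i$ and against $v$, rest on the weighted
John-Nirenberg inequality `IsAInftyMeasure.exists_lintegral_rpow_le`. Its dyadic stopping argument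
runs with the measure $\sigma$ itself: all it needs from $A_\infty$ is that a subset of at most half
the volume of a cube carries at most a fraction $\gamma<1$ of its $\sigma$-measure. Hölder's
inequality supplies this both for $A_q$ weights and for the dual weights
(`isAInftyMeasure_withDensity`). -/

/-! ### The John-Nirenberg inequality along a dyadic filtration -/

/-- A nested sequence of countable partitions: `D k x` is the cell of level `k` that contains
`x`. The measure of a cell is at most `κ` times that of any of its children. -/
structure IsDyadicSystem {X : Type*} [MeasurableSpace X] (μ : Measure X) (D : ℕ → X → Set X)
    (κ : ℝ≥0) : Prop where
  measurableSet : ∀ k x, MeasurableSet (D k x)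
  mem : ∀ k x, x ∈ D k x
  eq_of_mem : ∀ k x y, y ∈ D k x → D k y = D k x
  succ_subset : ∀ k x, D (k + 1) x ⊆ D k x
  countable : ∀ k, (Set.range (D k)).Countable
  measure_ne_zero : ∀ k x, μ (D k x) ≠ 0
  measure_ne_top : ∀ k x, μ (D k x) ≠ ∞
  measure_le : ∀ k x, μ (D k x) ≤ κ * μ (D (k + 1) x)
  one_le : 1 ≤ κ

theorem IsDyadicSystem.antitone {X : Type*} [MeasurableSpace X] {μ : Measure X}
    {D : ℕ → X → Set X} {κ : ℝ≥0} (hD : IsDyadicSystem μ D κ) (x : X) :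
    Antitone fun k => D k x :=
  antitone_nat_of_succ_le fun k => hD.succ_subset k x

/-- The function that is constant on every cell is measurable. -/
theorem IsDyadicSystem.measurable_comp {X β : Type*} [MeasurableSpace X] [MeasurableSpace β]
    {μ : Measure X} {D : ℕ → X → Set X} {κ : ℝ≥0} (hD : IsDyadicSystem μ D κ) (k : ℕ)
    (F : Set X → β) : Measurable fun x => F (D k x) := by
  intro s _
  have : (fun x => F (D k x)) ⁻¹' s = ⋃₀ {R | R ∈ Set.range (D k) ∧ F R ∈ s} := by
    ext x
    simp only [Set.mem_preimage, Set.mem_sUnion, Set.mem_ofPred_eq]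
    constructor
    · intro h
      exact ⟨D k x, ⟨⟨x, rfl⟩, h⟩, hD.mem k x⟩
    · rintro ⟨R, ⟨⟨y, rfl⟩, h⟩, hx⟩
      rwa [hD.eq_of_mem k y x hx]
  rw [this]
  refine MeasurableSet.sUnion ((hD.countable k).mono fun R hR => hR.1) ?_
  rintro R ⟨⟨y, rfl⟩, -⟩
  exact hD.measurableSet k y

/-- The form multiplied by `μ s` lets the measure be cancelled later, against a bound that carries
the same factor. -/
theorem enorm_setAverage_sub_mul_le {X E : Type*} [MeasurableSpace X] [NormedAddCommGroup E]
    [NormedSpace ℝ E] [CompleteSpace E] {μ : Measure X} {s : Set X} {f : X → E}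
    (h0 : μ s ≠ 0) (h1 : μ s ≠ ∞) (hf : IntegrableOn f s μ) (c : E) :
    ‖(⨍ y in s, f y ∂μ) - c‖ₑ * μ s ≤ ∫⁻ y in s, ‖f y - c‖ₑ ∂μ := by
  have hc : IntegrableOn (fun _ => c) s μ := integrableOn_const h1
  have h2 : μ.real s ≠ 0 := by simp [Measure.real, ENNReal.toReal_eq_zero_iff, h0, h1]
  have h3 : ∫ y in s, (f y - c) ∂μ = μ.real s • ((⨍ y in s, f y ∂μ) - c) := by
    rw [integral_sub hf hc, setAverage_eq, smul_sub, smul_smul, mul_inv_cancel₀ h2, one_smul,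
      setIntegral_const]
  have h4 : ‖(⨍ y in s, f y ∂μ) - c‖ₑ * μ s = ‖∫ y in s, (f y - c) ∂μ‖ₑ := by
    rw [h3, enorm_smul, mul_comm]
    congr 1
    rw [Real.enorm_of_nonneg (by positivity), Measure.real, ENNReal.ofReal_toReal h1]
  rw [h4]
  exact enorm_integral_le_lintegral_enorm _

/-- This and its reverse add up bounds over the disjoint stopping cells. -/
theorem setLIntegral_sUnion_le {X : Type*} [MeasurableSpace X] {σ : Measure X} {S : Set (Set X)}
    (hS : S.Countable) (hm : ∀ R ∈ S, MeasurableSet R) (hd : S.PairwiseDisjoint id)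
    {g : X → ℝ≥0∞} {c : ℝ≥0∞} (h : ∀ R ∈ S, ∫⁻ y in R, g y ∂σ ≤ c * σ R) :
    ∫⁻ y in ⋃₀ S, g y ∂σ ≤ c * σ (⋃₀ S) := by
  rw [measure_sUnion hS hd hm, Set.sUnion_eq_biUnion, lintegral_biUnion hS hm hd,
    ← ENNReal.tsum_mul_left]
  exact ENNReal.tsum_le_tsum fun R => h R R.2

theorem le_setLIntegral_sUnion {X : Type*} [MeasurableSpace X] {σ : Measure X} {S : Set (Set X)}
    (hS : S.Countable) (hm : ∀ R ∈ S, MeasurableSet R) (hd : S.PairwiseDisjoint id)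
    {g : X → ℝ≥0∞} {c : ℝ≥0∞} (h : ∀ R ∈ S, c * σ R ≤ ∫⁻ y in R, g y ∂σ) :
    c * σ (⋃₀ S) ≤ ∫⁻ y in ⋃₀ S, g y ∂σ := by
  rw [measure_sUnion hS hd hm, Set.sUnion_eq_biUnion, lintegral_biUnion hS hm hd,
    ← ENNReal.tsum_mul_left]
  exact ENNReal.tsum_le_tsum fun R => h R R.2

/-- The John-Nirenberg inequality for the averages of `b` over the cells of level `N`, with
respect to a measure `σ` for which subsets of small `μ`-measure of a cell do not carry almost
all of the `σ`-measure. -/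
theorem IsDyadicSystem.lintegral_exp_average_le {X E : Type*} [MeasurableSpace X]
    [NormedAddCommGroup E] [NormedSpace ℝ E] [CompleteSpace E] {μ σ : Measure X}
    {D : ℕ → X → Set X} {κ : ℝ≥0} (hD : IsDyadicSystem μ D κ) {b : X → E}
    (hb : ∀ k x, IntegrableOn b (D k x) μ) {A : ℝ≥0} (hA : 0 < A)
    (hbA : ∀ k x, ∫⁻ y in D k x, ‖b y - ⨍ z in D k x, b z ∂μ‖ₑ ∂μ ≤ A * μ (D k x))
    {γ a M : ℝ≥0} (hσ : ∀ k x, ∀ F ⊆ D k x, MeasurableSet F → 2 * μ F ≤ μ (D k x) →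
      σ F ≤ γ * σ (D k x))
    {ε : ℝ} (hε : 0 ≤ ε) (ha : Real.exp (ε * (κ * (2 * A))) ≤ a)
    (haM : a + a * γ * M ≤ M) (N : ℕ) :
    ∀ j k, k + j = N → ∀ x, ∫⁻ y in D k x, ENNReal.ofReal (Real.exp (ε *
      ‖(⨍ z in D N y, b z ∂μ) - ⨍ z in D k x, b z ∂μ‖)) ∂σ ≤ M * σ (D k x) := by
  -- A jump of size at most $2\kappa A$, the most that one stopping step can produce, costs a factor
  -- `a` in the exponential.
  have key : ∀ u w : E, ‖w‖ₑ ≤ κ * (2 * A) → ENNReal.ofReal (Real.exp (ε * ‖u + w‖)) ≤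
      a * ENNReal.ofReal (Real.exp (ε * ‖u‖)) := by
    intro u w hw
    have hw' : ‖w‖ ≤ κ * (2 * A) := by
      have : ‖w‖₊ ≤ κ * (2 * A) := by exact_mod_cast hw
      exact_mod_cast this
    have e1 : (a : ℝ≥0∞) = ENNReal.ofReal (a : ℝ) := by simp
    rw [e1, ← ENNReal.ofReal_mul a.coe_nonneg]
    refine ENNReal.ofReal_le_ofReal ?_
    calc Real.exp (ε * ‖u + w‖) ≤ Real.exp (ε * (κ * (2 * A)) + ε * ‖u‖) := by
          refine Real.exp_le_exp.2 ?_
          rw [← mul_add]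
          refine mul_le_mul_of_nonneg_left ?_ hε
          linarith [norm_add_le u w]
      _ = Real.exp (ε * (κ * (2 * A))) * Real.exp (ε * ‖u‖) := Real.exp_add _ _
      _ ≤ _ := mul_le_mul_of_nonneg_right ha (Real.exp_pos _).le
  intro j
  -- `j` counts the levels left down to `N`; a stopping cell lies strictly below level `k`, so the
  -- hypothesis applies to it.
  induction j using Nat.strong_induction_on with
  | _ j ih =>
  intro k hk x
  set Q := D k x with hQ
  set c := ⨍ z in Q, b z ∂μ with hc
  -- The stopping condition: the mean deviation from the average `c` of the top cell exceeds $2A$ on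
  -- the cell of level `i`.
  let exceeds : ℕ → X → Prop := fun i y =>
    k ≤ i ∧ i ≤ N ∧ (2 * A : ℝ≥0∞) * μ (D i y) < ∫⁻ z in D i y, ‖b z - c‖ₑ ∂μ
  have hexceeds : ∀ i y z, z ∈ D i y → ∀ i' ≤ i, (exceeds i' z ↔ exceeds i' y) := by
    intro i y z hz i' hi'
    have : D i' z = D i' y := hD.eq_of_mem _ _ _ (hD.antitone y hi' hz)
    simp only [exceeds, this]
  -- The maximal cells on which the condition holds, that is, those of the first level at which it
  -- holds.
  let S : Set (Set X) := {R | ∃ y ∈ Q, ∃ i, exceeds i y ∧ (∀ i' < i, ¬ exceeds i' y) ∧ R = D i y}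
  have hSc : S.Countable := by
    refine (Set.countable_iUnion hD.countable).mono ?_
    rintro R ⟨y, -, i, -, -, rfl⟩
    exact Set.mem_iUnion.2 ⟨i, y, rfl⟩
  have hSm : ∀ R ∈ S, MeasurableSet R := by
    rintro R ⟨y, -, i, -, -, rfl⟩
    exact hD.measurableSet i y
  have hSd : S.PairwiseDisjoint id := by
    rintro R ⟨y, -, i, h1, h2, rfl⟩ R' ⟨y', -, i', h1', h2', rfl⟩ hne
    rw [Function.onFun, id, id, Set.disjoint_left]
    intro z hz hz'
    apply hne
    have hi : i = i' := by
      rcases lt_trichotomy i i' with h | h | h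
      · exact absurd ((hexceeds i' y' z hz' i h.le).1 ((hexceeds i y z hz i le_rfl).2 h1)) (h2' i h)
      · exact h
      · exact absurd ((hexceeds i y z hz i' h.le).1 ((hexceeds i' y' z hz' i' le_rfl).2 h1')) (h2 i' h)
    subst hi
    rw [← hD.eq_of_mem _ _ _ hz, ← hD.eq_of_mem _ _ _ hz']
  have hcell : ∀ i y, y ∈ Q → k ≤ i → D i y ⊆ Q := by
    intro i y hy hi
    rw [hQ, ← hD.eq_of_mem _ _ _ hy]
    exact hD.antitone y hi
  have hSQ : ⋃₀ S ⊆ Q := by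
    refine Set.sUnion_subset ?_
    rintro R ⟨y, hy, i, h1, -, rfl⟩
    exact hcell i y hy h1.1
  have hSmeas : MeasurableSet (⋃₀ S) := MeasurableSet.sUnion hSc hSm
  -- Chebyshev: the total deviation on `Q` is at most $A\mu(Q)$, and on the stopping cells it is at
  -- least $2A$ times their measure.
  have hSμ : 2 * μ (⋃₀ S) ≤ μ Q := by
    have h1 : (2 * A : ℝ≥0∞) * μ (⋃₀ S) ≤ A * μ Q := by
      refine (le_setLIntegral_sUnion (g := fun z => ‖b z - c‖ₑ) hSc hSm hSd ?_).trans
        ((lintegral_mono_set hSQ).trans (hbA k x))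
      rintro R ⟨y, hy, i, h1, -, rfl⟩
      exact h1.2.2.le
    rw [mul_comm (2 : ℝ≥0∞), mul_assoc] at h1
    exact (ENNReal.mul_le_mul_iff_right (by simpa using hA.ne') ENNReal.coe_ne_top).1 h1
  have hSσ := hσ k x _ hSQ hSmeas hSμ
  -- The top cell does not stop, so every stopping cell has a parent inside `Q`, on which the mean
  -- deviation is still at most $2A$.
  have hnot : ¬ ∃ y ∈ Q, exceeds k y := by
    rintro ⟨y, hy, -, -, h3⟩
    rw [hD.eq_of_mem _ _ _ hy] at h3
    refine absurd (h3.trans_le (hbA k x)) (not_lt.2 ?_)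
    gcongr
    exact le_mul_of_one_le_left (by simp) (by norm_num)
  have hin : ∫⁻ y in ⋃₀ S, ENNReal.ofReal (Real.exp (ε * ‖(⨍ z in D N y, b z ∂μ) - c‖)) ∂σ ≤
      (a * M : ℝ≥0∞) * σ (⋃₀ S) := by
    refine setLIntegral_sUnion_le hSc hSm hSd ?_
    rintro R ⟨y, hy, i, h1, h2, rfl⟩
    have hki : k < i := lt_of_le_of_ne h1.1 fun h => hnot ⟨y, hy, by rw [h]; exact h1⟩
    obtain ⟨i', rfl⟩ : ∃ i', i = i' + 1 := ⟨i - 1, by omega⟩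
    -- Passing from the parent to the stopping cell loses only the ratio `κ` of their measures.
    have h3 : ‖(⨍ z in D (i' + 1) y, b z ∂μ) - c‖ₑ ≤ κ * (2 * A) := by
      have h4 := enorm_setAverage_sub_mul_le (hD.measure_ne_zero (i' + 1) y)
        (hD.measure_ne_top (i' + 1) y) (hb (i' + 1) y) c
      have h5 : ∫⁻ z in D i' y, ‖b z - c‖ₑ ∂μ ≤ (2 * A : ℝ≥0∞) * μ (D i' y) := by
        have := h2 i' (by omega)
        by_contra h6
        exact this ⟨by omega, by have := h1.2.1; omega, not_le.1 h6⟩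
      have h6 := (h4.trans (lintegral_mono_set (hD.succ_subset i' y))).trans
        (h5.trans (mul_le_mul_right (hD.measure_le i' y) _))
      rw [← mul_assoc, mul_comm (2 * A : ℝ≥0∞)] at h6
      exact (ENNReal.mul_le_mul_iff_left (hD.measure_ne_zero _ _) (hD.measure_ne_top _ _)).1 h6
    have h7 := ih (N - (i' + 1)) (by have := h1.2.1; omega) (i' + 1)
      (by have := h1.2.1; omega) y
    calc _ ≤ ∫⁻ w in D (i' + 1) y, a * ENNReal.ofReal (Real.exp (ε *
          ‖(⨍ z in D N w, b z ∂μ) - ⨍ z in D (i' + 1) y, b z ∂μ‖)) ∂σ := by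
          refine lintegral_mono fun w => ?_
          have := key ((⨍ z in D N w, b z ∂μ) - ⨍ z in D (i' + 1) y, b z ∂μ) _ h3
          rwa [sub_add_sub_cancel] at this
      _ = a * ∫⁻ w in D (i' + 1) y, ENNReal.ofReal (Real.exp (ε *
          ‖(⨍ z in D N w, b z ∂μ) - ⨍ z in D (i' + 1) y, b z ∂μ‖)) ∂σ :=
          lintegral_const_mul' _ _ ENNReal.coe_ne_top
      _ ≤ a * (M * σ (D (i' + 1) y)) := by gcongr
      _ = _ := by rw [mul_assoc]
  -- Off the stopping cells the condition fails even at level `N`, so there the average of level `N`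
  -- is within $2A$ of `c`.
  have hout : ∫⁻ y in Q \ ⋃₀ S, ENNReal.ofReal (Real.exp (ε * ‖(⨍ z in D N y, b z ∂μ) - c‖)) ∂σ ≤
      a * σ Q := by
    calc _ ≤ ∫⁻ y in Q \ ⋃₀ S, a ∂σ := by
          refine setLIntegral_mono' ((hD.measurableSet k x).diff hSmeas) fun y hy => ?_
          have h1 : ¬ exceeds N y := by
            classical
            intro h
            have hex : ∃ i, exceeds i y := ⟨N, h⟩
            exact hy.2 ⟨_, ⟨y, hy.1, Nat.find hex, Nat.find_spec hex,
              fun i' hi' => Nat.find_min hex hi', rfl⟩, hD.mem _ _⟩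
          have h2 : ∫⁻ z in D N y, ‖b z - c‖ₑ ∂μ ≤ (2 * A : ℝ≥0∞) * μ (D N y) := by
            by_contra h6
            exact h1 ⟨by omega, le_rfl, not_le.1 h6⟩
          have h4 := (enorm_setAverage_sub_mul_le (hD.measure_ne_zero N y)
            (hD.measure_ne_top N y) (hb N y) c).trans h2
          have h5 := (ENNReal.mul_le_mul_iff_left (hD.measure_ne_zero _ _)
            (hD.measure_ne_top _ _)).1 h4
          have h6 := key 0 _ (h5.trans (le_mul_of_one_le_left (by simp)
            (by exact_mod_cast hD.one_le)))
          simpa using h6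
      _ = a * σ (Q \ ⋃₀ S) := by simp
      _ ≤ _ := by gcongr; exact Set.sdiff_subset
  rw [← lintegral_inter_add_sdiff _ Q hSmeas, Set.inter_eq_right.2 hSQ]
  calc _ ≤ (a * M : ℝ≥0∞) * (γ * σ Q) + a * σ Q := by gcongr; exact hin.trans (by gcongr)
    _ = ((a + a * γ * M : ℝ≥0) : ℝ≥0∞) * σ Q := by push_cast; ring
    _ ≤ _ := by gcongr

/-- The John-Nirenberg inequality on a cell of a dyadic system. -/
theorem IsDyadicSystem.exists_lintegral_exp_le {X E : Type*} [MeasurableSpace X]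
    [NormedAddCommGroup E] [NormedSpace ℝ E] [CompleteSpace E] {κ A γ : ℝ≥0} (hκ : 1 ≤ κ) (hA : 0 < A) (hγ : γ < 1) :
    ∃ ε > 0, ∃ M : ℝ≥0, ∀ (μ σ : Measure X) (D : ℕ → X → Set X) (_ : IsDyadicSystem μ D κ)
      (b : X → E), (∀ k x, IntegrableOn b (D k x) μ) →
      (∀ k x, ∫⁻ y in D k x, ‖b y - ⨍ z in D k x, b z ∂μ‖ₑ ∂μ ≤ A * μ (D k x)) →
      (∀ k x, ∀ F ⊆ D k x, MeasurableSet F → 2 * μ F ≤ μ (D k x) → σ F ≤ γ * σ (D k x)) →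
      (∀ᵐ y ∂σ, Filter.Tendsto (fun N => ⨍ z in D N y, b z ∂μ) Filter.atTop (nhds (b y))) →
      ∀ x, ∫⁻ y in D 0 x, ENNReal.ofReal (Real.exp (ε * ‖b y - ⨍ z in D 0 x, b z ∂μ‖)) ∂σ ≤
        M * σ (D 0 x) := by
  have hγ' : (γ : ℝ) < 1 := by exact_mod_cast hγ
  have hΛ : (0 : ℝ) < κ * (2 * A) := by
    have : 0 < κ * (2 * A) := by positivity
    exact_mod_cast this
  have hγ0 : (0 : ℝ) ≤ γ := γ.2
  have hone : (1 : ℝ) < 2 / (1 + γ) := by rw [lt_div_iff₀ (by positivity)]; linarith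
  -- Since $\gamma<1$, this choice gives $a>1$ and $a\gamma<1$. The first makes $\varepsilon=\log
  -- a/(2\kappa A)$ positive; the second makes $M=a/(1-a\gamma)=2/(1-\gamma)$ the fixed point of
  -- $M\mapsto a+a\gamma M$.
  obtain ⟨a, ha⟩ : ∃ a : ℝ≥0, (a : ℝ) = 2 / (1 + γ) := ⟨⟨_, by positivity⟩, rfl⟩
  obtain ⟨M, hM⟩ : ∃ M : ℝ≥0, (M : ℝ) = 2 / (1 - γ) :=
    ⟨⟨_, div_nonneg zero_le_two (by linarith)⟩, rfl⟩
  refine ⟨Real.log a / (κ * (2 * A)), div_pos (Real.log_pos (ha ▸ hone)) hΛ, M, ?_⟩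
  intro μ σ D hD b hb hbA hσ hlim x
  set ε := Real.log a / (κ * (2 * A)) with hε
  have hε0 : 0 ≤ ε := (div_pos (Real.log_pos (ha ▸ hone)) hΛ).le
  have hbound := fun N => hD.lintegral_exp_average_le (a := a) (M := M) hb hA hbA hσ hε0
    (by
      rw [hε, div_mul_cancel₀ _ hΛ.ne', Real.exp_log (by rw [ha]; positivity)])
    (by
      rw [← NNReal.coe_le_coe]
      push_cast
      rw [ha, hM]
      have h1 : (1 - γ : ℝ) ≠ 0 := by linarith
      have h2 : (1 + γ : ℝ) ≠ 0 := by positivity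
      apply le_of_eq
      field_simp
      ring) N N 0 (by simp) x
  have hmeas : ∀ N, Measurable fun y => ENNReal.ofReal (Real.exp (ε *
      ‖(⨍ z in D N y, b z ∂μ) - ⨍ z in D 0 x, b z ∂μ‖)) := fun N =>
    hD.measurable_comp N fun R => ENNReal.ofReal (Real.exp (ε *
      ‖(⨍ z in R, b z ∂μ) - ⨍ z in D 0 x, b z ∂μ‖))
  -- The bound is uniform in `N`, so Fatou's lemma passes from averages to `b` itself.
  calc _ ≤ ∫⁻ y in D 0 x, Filter.liminf (fun N => ENNReal.ofReal (Real.exp (ε *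
        ‖(⨍ z in D N y, b z ∂μ) - ⨍ z in D 0 x, b z ∂μ‖))) Filter.atTop ∂σ := by
        refine lintegral_mono_ae ?_
        filter_upwards [ae_restrict_of_ae hlim] with y hy
        refine le_of_eq (Filter.Tendsto.liminf_eq ?_).symm
        refine (ENNReal.continuous_ofReal.tendsto _).comp ?_
        refine (Real.continuous_exp.tendsto _).comp ?_
        exact ((hy.sub_const _).norm).const_mul _
    _ ≤ Filter.liminf (fun N => ∫⁻ y in D 0 x, ENNReal.ofReal (Real.exp (ε *
        ‖(⨍ z in D N y, b z ∂μ) - ⨍ z in D 0 x, b z ∂μ‖)) ∂σ) Filter.atTop :=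
        lintegral_liminf_le hmeas
    _ ≤ _ := Filter.liminf_le_of_le (by isBoundedDefault)
        fun c hc => by
          obtain ⟨N, hN⟩ := hc.exists
          exact hN.trans (hbound N)

/-! ### Dyadic cubes in Euclidean space -/

/-- The dyadic cube of level `k` that contains `y`, in the grid whose cube of level `0` with
center `x₀` has side length `2 r`. -/
def gridCell {n : ℕ} (x₀ : Rn n) (r : ℝ) (k : ℕ) (y : Rn n) : Set (Rn n) :=
  {z | ∀ i, ⌊2 ^ k * ((z i - x₀ i + r) / (2 * r))⌋ = ⌊2 ^ k * ((y i - x₀ i + r) / (2 * r))⌋}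

theorem gridCell_eq_preimage {n : ℕ} (x₀ : Rn n) {r : ℝ} (hr : 0 < r) (k : ℕ) (y : Rn n) :
    ∃ a : Fin n → ℝ, gridCell x₀ r k y = (WithLp.ofLp : Rn n → Fin n → ℝ) ⁻¹'
      Set.pi Set.univ fun i => Set.Ico (a i) (a i + 2 * r / 2 ^ k) := by
  refine ⟨fun i => x₀ i - r + 2 * r / 2 ^ k * ⌊2 ^ k * ((y i - x₀ i + r) / (2 * r))⌋, ?_⟩
  ext z
  simp only [gridCell, Set.mem_ofPred_eq, Set.mem_preimage, Set.mem_pi, Set.mem_univ,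
    forall_true_left, Set.mem_Ico]
  refine forall_congr' fun i => ?_
  rw [Int.floor_eq_iff]
  set j : ℝ := (⌊2 ^ k * ((y i - x₀ i + r) / (2 * r))⌋ : ℝ)
  have h2 : (0 : ℝ) < 2 ^ k := by positivity
  have e : z i = x₀ i - r + 2 * r / 2 ^ k * (2 ^ k * ((z i - x₀ i + r) / (2 * r))) := by
    field_simp
    ring
  have hp : 0 < 2 * r / 2 ^ k := by positivity
  set u := 2 ^ k * ((z i - x₀ i + r) / (2 * r))
  rw [e]
  constructor
  · rintro ⟨h3, h4⟩
    constructor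
    · gcongr
    · nlinarith
  · rintro ⟨h3, h4⟩
    constructor
    · have : 2 * r / 2 ^ k * j ≤ 2 * r / 2 ^ k * u := by linarith
      exact le_of_mul_le_mul_left this hp
    · have : 2 * r / 2 ^ k * u < 2 * r / 2 ^ k * (j + 1) := by linarith
      exact lt_of_mul_lt_mul_left this hp.le

theorem measurableSet_gridCell {n : ℕ} (x₀ : Rn n) {r : ℝ} (hr : 0 < r) (k : ℕ) (y : Rn n) :
    MeasurableSet (gridCell x₀ r k y) := by
  obtain ⟨a, ha⟩ := gridCell_eq_preimage x₀ hr k y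
  rw [ha]
  exact (PiLp.volume_preserving_ofLp (Fin n)).measurable
    (MeasurableSet.univ_pi fun i => measurableSet_Ico)

theorem volume_gridCell {n : ℕ} (x₀ : Rn n) {r : ℝ} (hr : 0 < r) (k : ℕ) (y : Rn n) :
    volume (gridCell x₀ r k y) = ENNReal.ofReal (2 * r / 2 ^ k) ^ n := by
  obtain ⟨a, ha⟩ := gridCell_eq_preimage x₀ hr k y
  rw [ha, (PiLp.volume_preserving_ofLp (Fin n)).measure_preimage
    (MeasurableSet.univ_pi fun i => measurableSet_Ico).nullMeasurableSet, volume_pi_pi]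
  simp

theorem isDyadicSystem_gridCell {n : ℕ} (x₀ : Rn n) {r : ℝ} (hr : 0 < r) :
    IsDyadicSystem volume (gridCell x₀ r) (2 ^ n) where
  measurableSet := measurableSet_gridCell x₀ hr
  mem k x i := rfl
  eq_of_mem k x y hy := by
    ext z
    simp only [gridCell, Set.mem_ofPred_eq] at hy ⊢
    simp only [hy]
  succ_subset k x z hz i := by
    -- Nestedness of the cubes: the index at level `k` is half the index at level `k + 1`, rounded
    -- down.
    have key : ∀ w : ℝ, ⌊2 ^ k * w⌋ = ⌊2 ^ (k + 1) * w⌋ / 2 := by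
      intro w
      have := Int.floor_div_natCast (2 ^ (k + 1) * w) 2
      rw [← Nat.cast_ofNat (R := ℤ), ← this]
      congr 1
      push_cast
      ring
    rw [key, key, hz i]
  countable k := by
    let F : (Fin n → ℤ) → Set (Rn n) := fun j =>
      {z | ∀ i, ⌊2 ^ k * ((z i - x₀ i + r) / (2 * r))⌋ = j i}
    refine (Set.countable_range F).mono ?_
    rintro _ ⟨y, rfl⟩
    exact ⟨fun i => ⌊2 ^ k * ((y i - x₀ i + r) / (2 * r))⌋, rfl⟩
  measure_ne_zero k x := by
    rw [volume_gridCell x₀ hr]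
    have : 0 < 2 * r / 2 ^ k := by positivity
    exact pow_ne_zero _ (by simpa using this)
  measure_ne_top k x := by
    rw [volume_gridCell x₀ hr]
    exact ENNReal.pow_ne_top ENNReal.ofReal_ne_top
  measure_le k x := by
    rw [volume_gridCell x₀ hr, volume_gridCell x₀ hr]
    push_cast
    rw [← mul_pow]
    have : (2 : ℝ≥0∞) = ENNReal.ofReal 2 := by simp
    rw [this, ← ENNReal.ofReal_mul zero_le_two]
    apply le_of_eq
    congr 2
    rw [pow_succ]
    field_simp
  one_le := one_le_pow₀ one_le_two

theorem ball_subset_gridCell {n : ℕ} (x₀ : Rn n) {r : ℝ} (hr : 0 < r) :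
    Metric.ball x₀ r ⊆ gridCell x₀ r 0 x₀ := by
  intro z hz i
  have h1 : |z i - x₀ i| < r := by
    have h2 := PiLp.norm_apply_le (p := 2) (z - x₀) i
    rw [Metric.mem_ball, dist_eq_norm] at hz
    have h3 : ‖(z - x₀) i‖ = |z i - x₀ i| := rfl
    rw [h3] at h2
    exact h2.trans_lt hz
  rw [abs_lt] at h1
  have e1 : ⌊2 ^ 0 * ((z i - x₀ i + r) / (2 * r))⌋ = 0 := by
    rw [Int.floor_eq_zero_iff, pow_zero, one_mul]
    exact ⟨div_nonneg (by linarith) (by linarith), (div_lt_one (by linarith)).2 (by linarith)⟩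
  have e2 : ⌊2 ^ 0 * ((x₀ i - x₀ i + r) / (2 * r))⌋ = 0 := by
    rw [Int.floor_eq_zero_iff, pow_zero, one_mul]
    exact ⟨div_nonneg (by linarith) (by linarith), (div_lt_one (by linarith)).2 (by linarith)⟩
  rw [e1, e2]

/-- A cube of side $\ell$ has diameter at most $\sqrt n\,\ell<(n+1)\ell$. The ball may be centred at
any point `y` of the cube, which Lebesgue differentiation at `y` needs. -/
theorem gridCell_subset_ball {n : ℕ} (x₀ : Rn n) {r : ℝ} (hr : 0 < r) (k : ℕ) (y : Rn n) :
    gridCell x₀ r k y ⊆ Metric.ball y ((n + 1) * (2 * r / 2 ^ k)) := by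
  have hp : 0 < 2 * r / 2 ^ k := by positivity
  intro z hz
  have hy : y ∈ gridCell x₀ r k y := fun i => rfl
  obtain ⟨a, ha⟩ := gridCell_eq_preimage x₀ hr k y
  rw [ha] at hy hz
  simp only [Set.mem_preimage, Set.mem_pi, Set.mem_univ, forall_true_left, Set.mem_Ico] at hy hz
  rw [Metric.mem_ball, EuclideanSpace.dist_eq]
  set ℓ := 2 * r / 2 ^ k
  rw [Real.sqrt_lt' (by positivity)]
  calc ∑ i, dist (z i) (y i) ^ 2 ≤ ∑ _i : Fin n, ℓ ^ 2 := by
        refine Finset.sum_le_sum fun i _ => ?_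
        rw [Real.dist_eq, sq_abs, sq_le_sq, abs_of_pos hp, abs_le]
        constructor <;> linarith [hy i, hz i]
    _ = n * ℓ ^ 2 := by simp
    _ < ((n + 1) * ℓ) ^ 2 := by
        rw [mul_pow]
        have : (0 : ℝ) ≤ n := n.cast_nonneg
        have : 0 < ℓ ^ 2 := by positivity
        gcongr
        nlinarith

/-- The ratio of the volumes of a cube and of its enclosing ball. -/
theorem exists_volume_ball_le_gridCell (n : ℕ) : ∃ c : ℝ≥0, ∀ (x₀ : Rn n) (r : ℝ), 0 < r →
    ∀ k y, volume (Metric.ball y ((n + 1) * (2 * r / 2 ^ k))) ≤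
      c * volume (gridCell x₀ r k y) := by
  refine ⟨(n + 1) ^ n * (volume (Metric.ball (0 : Rn n) 1)).toNNReal, fun x₀ r hr k y => ?_⟩
  have hp : 0 < 2 * r / 2 ^ k := by positivity
  rw [Measure.addHaar_ball_of_pos _ _ (by positivity), volume_gridCell x₀ hr, mul_pow,
    ENNReal.ofReal_mul (by positivity), ENNReal.ofReal_pow (by positivity),
    ENNReal.ofReal_pow (by positivity)]
  simp only [finrank_euclideanSpace, Fintype.card_fin, ENNReal.coe_mul]
  rw [ENNReal.coe_toNNReal measure_ball_lt_top.ne]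
  have : ENNReal.ofReal (n + 1 : ℝ) = (n + 1 : ℝ≥0∞) := by
    rw [ENNReal.ofReal_add (by positivity) (by positivity)]
    simp
  rw [this]
  apply le_of_eq
  push_cast
  ring

theorem integrableOn_ball_of_locallyIntegrable {n : ℕ} {E : Type*} [NormedAddCommGroup E]
    {b : Rn n → E} (hb : LocallyIntegrable b volume) (x : Rn n) (r : ℝ) :
    IntegrableOn b (Metric.ball x r) volume :=
  (hb.integrableOn_isCompact (isCompact_closedBall x r)).mono_set Metric.ball_subset_closedBall

/-- Lebesgue differentiation along dyadic cubes. -/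
theorem ae_tendsto_average_gridCell {n : ℕ} {E : Type*} [NormedAddCommGroup E] [NormedSpace ℝ E]
    [CompleteSpace E] {b : Rn n → E} (hb : LocallyIntegrable b volume) (x₀ : Rn n) {r : ℝ}
    (hr : 0 < r) : ∀ᵐ y, Filter.Tendsto (fun N => ⨍ z in gridCell x₀ r N y, b z) Filter.atTop
      (nhds (b y)) := by
  obtain ⟨c, hc⟩ := exists_volume_ball_le_gridCell n
  have hD := isDyadicSystem_gridCell x₀ hr
  filter_upwards [IsUnifLocDoublingMeasure.ae_tendsto_average_norm_sub (μ := volume) hb 1]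
    with y hy
  set δ : ℕ → ℝ := fun N => (n + 1) * (2 * r / 2 ^ N) with hδ
  have hδpos : ∀ N, 0 < δ N := fun N => by positivity
  have hδlim : Filter.Tendsto δ Filter.atTop (nhdsWithin 0 (Set.Ioi 0)) := by
    refine tendsto_nhdsWithin_iff.2 ⟨?_, Filter.Eventually.of_forall hδpos⟩
    have h1 : Filter.Tendsto (fun N : ℕ => (n + 1) * (2 * r) * (1 / 2 : ℝ) ^ N) Filter.atTop
        (nhds ((n + 1) * (2 * r) * 0)) :=
      (tendsto_pow_atTop_nhds_zero_of_lt_one (by norm_num) (by norm_num)).const_mul _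
    rw [mul_zero] at h1
    refine h1.congr fun N => ?_
    simp only [hδ, one_div, inv_pow]
    ring
  have h1 := hy (fun _ => y) δ hδlim (Filter.Eventually.of_forall fun N => by
    simpa using (hδpos N).le)
  rw [tendsto_iff_norm_sub_tendsto_zero]
  have h2 := h1.const_mul (c : ℝ)
  rw [mul_zero] at h2
  refine squeeze_zero (fun _ => norm_nonneg _) (fun N => ?_) h2
  -- The cube fills a fixed share of the closed ball of radius `δ N` about `y`, so the mean of
  -- $|b-b(y)|$ over the cube is at most `c` times the mean over that ball, which tends to zero.
  have hsub := (gridCell_subset_ball x₀ hr N y).trans Metric.ball_subset_closedBall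
  have hint := hb.integrableOn_isCompact (isCompact_closedBall y (δ N))
  have hint' : IntegrableOn (fun z => b z - b y) (Metric.closedBall y (δ N)) volume :=
    hint.sub (integrableOn_const measure_closedBall_lt_top.ne)
  have h3 := enorm_setAverage_sub_mul_le (hD.measure_ne_zero N y) (hD.measure_ne_top N y)
    (hint.mono_set hsub) (b y)
  have h4 : ∫⁻ z in Metric.closedBall y (δ N), ‖b z - b y‖ₑ =
      ENNReal.ofReal (⨍ z in Metric.closedBall y (δ N), ‖b z - b y‖) *
        volume (Metric.closedBall y (δ N)) := by
    have h5 : volume (Metric.closedBall y (δ N)) ≠ 0 :=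
      (Metric.measure_closedBall_pos _ _ (hδpos N)).ne'
    have h6 : volume (Metric.closedBall y (δ N)) ≠ ∞ := measure_closedBall_lt_top.ne
    rw [setAverage_eq, smul_eq_mul, ENNReal.ofReal_mul (by positivity), Measure.real,
      ENNReal.ofReal_inv_of_pos (ENNReal.toReal_pos h5 h6),
      ENNReal.ofReal_toReal h6, mul_right_comm, ENNReal.inv_mul_cancel h5 h6, one_mul,
      ofReal_integral_norm_eq_lintegral_enorm hint']
  have h7 : volume (Metric.closedBall y (δ N)) ≤ c * volume (gridCell x₀ r N y) := by
    rw [Measure.addHaar_closedBall _ _ (hδpos N).le, ← Measure.addHaar_ball_of_pos _ y (hδpos N)]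
    exact hc x₀ r hr N y
  have h8 := h3.trans ((lintegral_mono_set hsub).trans (h4.le.trans (mul_le_mul_right h7 _)))
  rw [← mul_assoc] at h8
  have h9 := (ENNReal.mul_le_mul_iff_left (hD.measure_ne_zero _ _) (hD.measure_ne_top _ _)).1 h8
  have h10 : (0 : ℝ) ≤ ⨍ z in Metric.closedBall y (δ N), ‖b z - b y‖ :=
    integral_nonneg fun z => norm_nonneg _
  have e1 : (c : ℝ≥0∞) = ENNReal.ofReal (c : ℝ) := by simp
  rw [e1, mul_comm, ← ENNReal.ofReal_mul c.coe_nonneg, ← ofReal_norm] at h9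
  exact (ENNReal.ofReal_le_ofReal_iff (by positivity)).1 h9

/-! ### Functions of bounded mean oscillation -/

/-- The constant is made positive because the Chebyshev step of the stopping argument divides by it.
-/
theorem IsBMO.exists_lintegral_le {n : ℕ} {𝕜 : Type*} [RCLike 𝕜] {b : Rn n → 𝕜} (hb : IsBMO b) :
    ∃ A : ℝ≥0, 0 < A ∧ ∀ (x : Rn n) (r : ℝ), 0 < r →
      ∫⁻ y in Metric.ball x r, ‖b y - ⨍ z in Metric.ball x r, b z‖ₑ ≤
        A * volume (Metric.ball x r) := by
  obtain ⟨hloc, C, hC⟩ := hb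
  refine ⟨C.toNNReal + 1, by positivity, fun x r hr => ?_⟩
  have h5 : volume (Metric.ball x r) ≠ 0 := (Metric.measure_ball_pos _ _ hr).ne'
  have h6 : volume (Metric.ball x r) ≠ ∞ := measure_ball_lt_top.ne
  have hint : IntegrableOn (fun y => b y - ⨍ z in Metric.ball x r, b z) (Metric.ball x r) volume :=
    (integrableOn_ball_of_locallyIntegrable hloc x r).sub (integrableOn_const h6)
  have h := hC x r hr
  rw [setAverage_eq, smul_eq_mul, Measure.real, inv_mul_le_iff₀ (ENNReal.toReal_pos h5 h6)] at h
  rw [← ofReal_integral_norm_eq_lintegral_enorm hint]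
  refine (ENNReal.ofReal_le_ofReal h).trans ?_
  rw [ENNReal.ofReal_mul (by positivity), ENNReal.ofReal_toReal h6, mul_comm]
  gcongr
  exact ENNReal.coe_le_coe.2 (le_add_of_nonneg_right zero_le_one)

/-- Shrinking the domain of integration to `s` costs only the ratio of volumes. It is applied to
cubes inside balls and to smaller concentric balls. -/
theorem enorm_average_sub_average_le {n : ℕ} {𝕜 : Type*} [RCLike 𝕜] {b : Rn n → 𝕜}
    (hb : LocallyIntegrable b volume) {A c : ℝ≥0} {x : Rn n} {r : ℝ} (hr : 0 < r)
    (hA : ∫⁻ y in Metric.ball x r, ‖b y - ⨍ z in Metric.ball x r, b z‖ₑ ≤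
      A * volume (Metric.ball x r)) {s : Set (Rn n)} (hs : s ⊆ Metric.ball x r)
    (hc : volume (Metric.ball x r) ≤ c * volume s) :
    ‖(⨍ y in s, b y) - ⨍ y in Metric.ball x r, b y‖ₑ ≤ A * c := by
  have h0 : volume s ≠ 0 := by
    intro h
    rw [h, mul_zero] at hc
    exact (Metric.measure_ball_pos volume x hr).ne' (le_antisymm hc zero_le)
  have h1 : volume s ≠ ∞ := ((measure_mono hs).trans_lt measure_ball_lt_top).ne
  have h2 := (enorm_setAverage_sub_mul_le h0 h1
    ((integrableOn_ball_of_locallyIntegrable hb x r).mono_set hs)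
    (⨍ y in Metric.ball x r, b y)).trans ((lintegral_mono_set hs).trans
      (hA.trans (mul_le_mul_right hc _)))
  rw [← mul_assoc] at h2
  exact (ENNReal.mul_le_mul_iff_left h0 h1).1 h2

theorem lintegral_enorm_sub_average_le {n : ℕ} {𝕜 : Type*} [RCLike 𝕜] {b : Rn n → 𝕜}
    (hb : LocallyIntegrable b volume) {A c : ℝ≥0} {x : Rn n} {r : ℝ} (hr : 0 < r)
    (hA : ∫⁻ y in Metric.ball x r, ‖b y - ⨍ z in Metric.ball x r, b z‖ₑ ≤
      A * volume (Metric.ball x r)) {s : Set (Rn n)} (hs : s ⊆ Metric.ball x r)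
    (hc : volume (Metric.ball x r) ≤ c * volume s) :
    ∫⁻ y in s, ‖b y - ⨍ z in s, b z‖ₑ ≤ (2 * A * c : ℝ≥0) * volume s := by
  have h1 := enorm_average_sub_average_le hb hr hA hs hc
  calc ∫⁻ y in s, ‖b y - ⨍ z in s, b z‖ₑ
      ≤ ∫⁻ y in s, (‖b y - ⨍ z in Metric.ball x r, b z‖ₑ + A * c) := by
        refine lintegral_mono fun y => ?_
        have : b y - ⨍ z in s, b z = (b y - ⨍ z in Metric.ball x r, b z) -
            ((⨍ z in s, b z) - ⨍ z in Metric.ball x r, b z) := by ring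
        rw [this]
        exact (enorm_sub_le).trans (add_le_add_right h1 _)
    _ = (∫⁻ y in s, ‖b y - ⨍ z in Metric.ball x r, b z‖ₑ) + A * c * volume s := by
        rw [lintegral_add_right _ measurable_const, setLIntegral_const]
    _ ≤ A * (c * volume s) + A * c * volume s := by
        gcongr
        exact (lintegral_mono_set hs).trans (hA.trans (by gcongr))
    _ = _ := by push_cast; ring

/-! ### Measures of class `A_∞` -/

/-- A measure that is comparable to Lebesgue measure in the sense of Muckenhoupt:
`(|F| / |B|) ^ s ≤ K σ(F) / σ(B)` for the measurable subsets `F` of a ball `B`. -/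
structure IsAInftyMeasure {n : ℕ} (σ : Measure (Rn n)) : Prop where
  absolutelyContinuous : σ ≪ volume
  ball_lt_top : ∀ x r, σ (Metric.ball x r) < ∞
  comparison : ∃ (K : ℝ≥0) (s : ℝ), 0 ≤ s ∧ ∀ (x : Rn n) (r : ℝ), 0 < r →
    ∀ F ⊆ Metric.ball x r, MeasurableSet F →
      volume F ^ s * σ (Metric.ball x r) ≤ K * (volume (Metric.ball x r) ^ s * σ F)

/-- The comparison with $|B|\le c|F|$ gives the constant $Kc^s$; it is raised by one so that it can
be inverted. In particular the measure is doubling. -/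
theorem IsAInftyMeasure.exists_ball_le {n : ℕ} {σ : Measure (Rn n)} (hσ : IsAInftyMeasure σ)
    (c : ℝ≥0) : ∃ L : ℝ≥0, 1 ≤ L ∧ ∀ (x : Rn n) (r : ℝ), 0 < r → ∀ F ⊆ Metric.ball x r,
      MeasurableSet F → volume (Metric.ball x r) ≤ c * volume F →
        σ (Metric.ball x r) ≤ L * σ F := by
  obtain ⟨K, s, hs, h⟩ := hσ.comparison
  refine ⟨K * c ^ s + 1, le_add_of_nonneg_left zero_le, fun x r hr F hF hFm hc => ?_⟩
  have h0 : volume F ≠ 0 := by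
    intro h
    rw [h, mul_zero] at hc
    exact (Metric.measure_ball_pos volume x hr).ne' (le_antisymm hc zero_le)
  have h1 : volume F ≠ ∞ := ((measure_mono hF).trans_lt measure_ball_lt_top).ne
  have h2 : volume F ^ s * σ (Metric.ball x r) ≤ volume F ^ s * ((K * c ^ s : ℝ≥0) * σ F) := by
    calc _ ≤ _ := h x r hr F hF hFm
      _ ≤ K * ((c * volume F) ^ s * σ F) := by gcongr
      _ = _ := by
        rw [ENNReal.mul_rpow_of_nonneg _ _ hs]
        push_cast
        rw [ENNReal.coe_rpow_of_nonneg _ hs]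
        ring
  have h3 := (ENNReal.mul_le_mul_iff_right (by simp [ENNReal.rpow_eq_zero_iff, h0, h1])
    (ENNReal.rpow_ne_top_of_nonneg hs h1)).1 h2
  refine h3.trans ?_
  gcongr
  exact le_add_of_nonneg_right zero_le_one

/-- The complement $Q\setminus F$ has at least half the volume of $Q$, hence at least the share
$1/(2c)$ of the ball, so it carries at least $L^{-1}\sigma(Q)$ and $\gamma=1-L^{-1}$ works. This is
the hypothesis on $\sigma$ in the stopping argument. -/
theorem IsAInftyMeasure.exists_compl_le {n : ℕ} {σ : Measure (Rn n)} (hσ : IsAInftyMeasure σ)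
    (c : ℝ≥0) : ∃ γ : ℝ≥0, γ < 1 ∧ ∀ (x : Rn n) (r : ℝ), 0 < r → ∀ Q ⊆ Metric.ball x r,
      MeasurableSet Q → volume (Metric.ball x r) ≤ c * volume Q → ∀ F ⊆ Q, MeasurableSet F →
        2 * volume F ≤ volume Q → σ F ≤ γ * σ Q := by
  obtain ⟨L, hL1, hL⟩ := hσ.exists_ball_le (c * 2)
  have hL0 : 0 < L := lt_of_lt_of_le one_pos hL1
  refine ⟨1 - L⁻¹, tsub_lt_self one_pos (inv_pos.2 hL0), fun x r hr Q hQ hQm hc F hF hFm hFQ => ?_⟩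
  have hfin : volume F ≠ ∞ := ((measure_mono (hF.trans hQ)).trans_lt measure_ball_lt_top).ne
  have h1 : volume Q ≤ 2 * volume (Q \ F) := by
    have h2 : volume F + volume (Q \ F) = volume Q := measure_add_sdiff hFm.nullMeasurableSet Q ▸ by
      rw [Set.union_eq_self_of_subset_left hF]
    have h3 : volume F ≤ volume (Q \ F) := by
      rw [← h2, two_mul] at hFQ
      exact (ENNReal.add_le_add_iff_left hfin).1 hFQ
    rw [← h2, two_mul]
    gcongr
  have h4 := hL x r hr (Q \ F) (Set.sdiff_subset.trans hQ) (hQm.diff hFm) (hc.trans (by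
    rw [ENNReal.coe_mul, mul_assoc]
    gcongr
    exact h1))
  have hσfin : σ (Q \ F) ≠ ∞ :=
    ((measure_mono (Set.sdiff_subset.trans hQ)).trans_lt (hσ.ball_lt_top x r)).ne
  have h5 : (L⁻¹ : ℝ≥0) * σ Q ≤ σ (Q \ F) := by
    have := (measure_mono hQ).trans h4
    rw [ENNReal.coe_inv hL0.ne']
    exact (ENNReal.inv_mul_le_iff (by simpa using hL0.ne') ENNReal.coe_ne_top).2 this
  have h6 : σ F + σ (Q \ F) = σ Q := measure_add_sdiff hFm.nullMeasurableSet Q ▸ by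
    rw [Set.union_eq_self_of_subset_left hF]
  have hQfin : σ Q ≠ ∞ := ((measure_mono hQ).trans_lt (hσ.ball_lt_top x r)).ne
  rw [ENNReal.coe_sub, ENNReal.sub_mul (fun _ _ => hQfin), ENNReal.coe_one, one_mul]
  refine ENNReal.le_sub_of_add_le_right (ENNReal.mul_ne_top ENNReal.coe_ne_top hQfin) ?_
  calc _ ≤ σ F + σ (Q \ F) := by gcongr
    _ = _ := h6

/-- The inequality $y\le e^y$ at $y=\varepsilon x/q$, raised to the power $q$; it trades exponential
integrability for moments of any order. -/
theorem rpow_le_mul_exp {x q ε : ℝ} (hx : 0 ≤ x) (hq : 0 < q) (hε : 0 < ε) :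
    x ^ q ≤ (q / ε) ^ q * Real.exp (ε * x) := by
  have h1 : x ≤ q / ε * Real.exp (ε * x / q) := by
    have := Real.add_one_le_exp (ε * x / q)
    calc x = q / ε * (ε * x / q) := by field_simp
      _ ≤ _ := by gcongr; linarith
  calc x ^ q ≤ (q / ε * Real.exp (ε * x / q)) ^ q := by gcongr
    _ = _ := by
      rw [Real.mul_rpow (by positivity) (Real.exp_pos _).le, ← Real.exp_mul,
        div_mul_cancel₀ _ hq.ne']

/-- The weighted John-Nirenberg inequality: the moments of the oscillation of a function of
bounded mean oscillation with respect to a measure of class `A_∞`. -/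
theorem IsAInftyMeasure.exists_lintegral_rpow_le {n : ℕ} {𝕜 : Type*} [RCLike 𝕜]
    {σ : Measure (Rn n)} (hσ : IsAInftyMeasure σ) {b : Rn n → 𝕜} (hb : IsBMO b) {q : ℝ}
    (hq : 0 < q) : ∃ C : ℝ≥0, ∀ (x : Rn n) (r : ℝ), 0 < r →
      ∫⁻ y in Metric.ball x r, (1 + ‖b y - ⨍ z in Metric.ball x r, b z‖ₑ) ^ q ∂σ ≤
        C * σ (Metric.ball x r) := by
  obtain ⟨A, hA0, hA⟩ := hb.exists_lintegral_le
  obtain ⟨c₀, hc₀⟩ := exists_volume_ball_le_gridCell n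
  -- Adding one makes the oscillation constant $2Ac$ on cubes positive.
  set c := c₀ + 1 with hc_def
  have hc : ∀ (x₀ : Rn n) (r : ℝ), 0 < r → ∀ k y,
      volume (Metric.ball y ((n + 1) * (2 * r / 2 ^ k))) ≤ c * volume (gridCell x₀ r k y) :=
    fun x₀ r hr k y => (hc₀ x₀ r hr k y).trans (by
      gcongr
      exact le_add_of_nonneg_right zero_le_one)
  obtain ⟨γ, hγ1, hγ⟩ := hσ.exists_compl_le c
  set c₁ : ℝ≥0 := (2 * (n + 1)) ^ n with hc₁
  obtain ⟨L, hL1, hL⟩ := hσ.exists_ball_le c₁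
  obtain ⟨ε, hε, M, hM⟩ := IsDyadicSystem.exists_lintegral_exp_le (X := Rn n) (E := 𝕜)
    (κ := 2 ^ n) (A := 2 * A * c) (γ := γ) (one_le_pow₀ one_le_two)
    (by positivity) hγ1
  -- This bounds $|b_Q-b_B|$, where $B\subseteq Q\subseteq B'$: both averages are compared with the
  -- one over $B'$, and `c₁` is the ratio $|B'|/|B|$.
  set Λ : ℝ≥0 := A * c₁ + A * c with hΛ
  set C₁ : ℝ≥0 := Real.toNNReal ((q / ε) ^ q * Real.exp (ε * (1 + Λ))) with hC₁
  refine ⟨C₁ * (M * L), fun x r hr => ?_⟩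
  have hpos : ∀ k : ℕ, 0 < ((n : ℝ) + 1) * (2 * r / 2 ^ k) := fun k => by positivity
  have h1 := hM volume σ (gridCell x r) (isDyadicSystem_gridCell x hr) b
    (fun k y => (integrableOn_ball_of_locallyIntegrable hb.1 _ _).mono_set
      (gridCell_subset_ball x hr k y))
    (fun k y => lintegral_enorm_sub_average_le hb.1 (hpos k) (hA y _ (hpos k))
      (gridCell_subset_ball x hr k y) (hc x r hr k y))
    (fun k y F hF hFm hF2 => hγ y _ (hpos k) _ (gridCell_subset_ball x hr k y)
      (measurableSet_gridCell x hr k y) (hc x r hr k y) F hF hFm hF2)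
    (hσ.absolutelyContinuous.ae_le (ae_tendsto_average_gridCell hb.1 x hr)) x
  set B := Metric.ball x r with hB
  set Q := gridCell x r 0 x with hQ
  set B' := Metric.ball x ((n + 1) * (2 * r / 2 ^ 0)) with hB'
  have hQB' : Q ⊆ B' := gridCell_subset_ball x hr 0 x
  have hBQ : B ⊆ Q := ball_subset_gridCell x hr
  have hvol : volume B' ≤ c₁ * volume B := by
    rw [hB', hB, Measure.addHaar_ball_of_pos _ _ (hpos 0), Measure.addHaar_ball_of_pos _ _ hr,
      ← mul_assoc]
    gcongr
    have e1 : (c₁ : ℝ≥0∞) = ENNReal.ofReal ((2 * (n + 1)) ^ n) := by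
      rw [← ENNReal.ofReal_coe_nnreal, hc₁]
      push_cast
      rfl
    rw [e1, ← ENNReal.ofReal_mul (by positivity)]
    refine ENNReal.ofReal_le_ofReal (le_of_eq ?_)
    simp only [finrank_euclideanSpace, Fintype.card_fin, pow_zero, div_one]
    rw [← mul_pow]
    ring
  have hσB' : σ B' ≤ L * σ B := hL x _ (hpos 0) B (hBQ.trans hQB') measurableSet_ball hvol
  have hd : ‖(⨍ z in Q, b z) - ⨍ z in B, b z‖ ≤ Λ := by
    have h2 := enorm_average_sub_average_le hb.1 (hpos 0) (hA x _ (hpos 0)) (hBQ.trans hQB') hvol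
    have h3 := enorm_average_sub_average_le hb.1 (hpos 0) (hA x _ (hpos 0)) hQB' (hc x r hr 0 x)
    have h4 : ‖(⨍ z in Q, b z) - ⨍ z in B, b z‖ₑ ≤ A * c₁ + A * c := by
      rw [← sub_sub_sub_cancel_right _ _ (⨍ z in B', b z), add_comm]
      exact enorm_sub_le.trans (add_le_add h3 h2)
    have h5 : ‖(⨍ z in Q, b z) - ⨍ z in B, b z‖₊ ≤ Λ := by
      rw [hΛ]
      exact_mod_cast h4
    exact_mod_cast h5
  calc _ ≤ ∫⁻ y in B, C₁ * ENNReal.ofReal (Real.exp (ε * ‖b y - ⨍ z in Q, b z‖)) ∂σ := by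
        refine lintegral_mono fun y => ?_
        have e1 : (1 + ‖b y - ⨍ z in B, b z‖ₑ) = ENNReal.ofReal (1 + ‖b y - ⨍ z in B, b z‖) := by
          rw [ENNReal.ofReal_add zero_le_one (norm_nonneg _), ofReal_norm, ENNReal.ofReal_one]
        rw [e1, ENNReal.ofReal_rpow_of_nonneg (by positivity) hq.le, hC₁,
          ← ENNReal.ofReal, ← ENNReal.ofReal_mul (by positivity)]
        refine ENNReal.ofReal_le_ofReal ?_
        refine (rpow_le_mul_exp (by positivity) hq hε).trans ?_
        rw [mul_assoc, ← Real.exp_add]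
        gcongr
        rw [← mul_add]
        refine mul_le_mul_of_nonneg_left ?_ hε.le
        have : b y - ⨍ z in B, b z = (b y - ⨍ z in Q, b z) +
          ((⨍ z in Q, b z) - ⨍ z in B, b z) := by ring
        rw [this]
        linarith [norm_add_le (b y - ⨍ z in Q, b z) ((⨍ z in Q, b z) - ⨍ z in B, b z)]
    _ = C₁ * ∫⁻ y in B, ENNReal.ofReal (Real.exp (ε * ‖b y - ⨍ z in Q, b z‖)) ∂σ :=
        lintegral_const_mul' _ _ ENNReal.coe_ne_top
    _ ≤ C₁ * (M * (L * σ B)) := by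
        gcongr
        refine (lintegral_mono_set hBQ).trans (h1.trans ?_)
        gcongr
        exact (measure_mono hQB').trans hσB'
    _ = _ := by push_cast; ring

/-! ### Weights and measures of class `A_∞` -/

theorem prod_rpow_eq_rpow_sum {ι : Type*} (s : Finset ι) {x : ℝ≥0∞} (h0 : x ≠ 0) (h1 : x ≠ ∞)
    (e : ι → ℝ) : ∏ i ∈ s, x ^ e i = x ^ ∑ i ∈ s, e i := by
  classical
  induction s using Finset.induction with
  | empty => simp
  | insert a s ha ih =>
    rw [Finset.prod_insert ha, Finset.sum_insert ha, ih, ENNReal.rpow_add _ _ h0 h1]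

theorem setLIntegral_ball_ne_zero {n : ℕ} {f : Rn n → ℝ≥0∞} (hf : AEMeasurable f volume)
    (h0 : ∀ᵐ y, f y ≠ 0) (x : Rn n) {r : ℝ} (hr : 0 < r) :
    ∫⁻ y in Metric.ball x r, f y ≠ 0 := by
  intro h
  rw [lintegral_eq_zero_iff' hf.restrict] at h
  have h1 : ∀ᵐ y ∂(volume.restrict (Metric.ball x r)), False := by
    filter_upwards [h, ae_restrict_of_ae h0] with y hy hy'
    exact hy' hy
  rw [Filter.eventually_false_iff_eq_bot, ae_eq_bot, Measure.restrict_eq_zero] at h1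
  exact (Metric.measure_ball_pos volume x hr).ne' h1

/-- Hölder's inequality for the exponents `e i`, applied to a product that is at least one. -/
theorem measure_le_prod_lintegral_rpow {X ι : Type*} [MeasurableSpace X] [Fintype ι]
    {μ : Measure X} {f : ι → X → ℝ≥0∞} (hf : ∀ i, AEMeasurable (f i) μ) {e : ι → ℝ}
    (he : ∀ i, 0 ≤ e i) (hsum : ∑ i, e i = 1) (h1 : ∀ᵐ y ∂μ, 1 ≤ ∏ i, f i y ^ e i) (F : Set X) :
    μ F ≤ ∏ i, (∫⁻ y in F, f i y ∂μ) ^ e i := by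
  calc μ F = ∫⁻ y in F, 1 ∂μ := by simp
    _ ≤ ∫⁻ y in F, ∏ i, f i y ^ e i ∂μ := lintegral_mono_ae (ae_restrict_of_ae h1)
    _ ≤ _ := ENNReal.lintegral_prod_norm_pow_le _ (fun i _ => (hf i).restrict) hsum
        fun i _ => he i

/-- If the geometric mean of the functions `f i` is at least `1` and the geometric means of their
averages over balls are bounded, then every `f i` is the density of a measure of class `A_∞`. -/
theorem isAInftyMeasure_withDensity {n : ℕ} {ι : Type*} [Fintype ι] {f : ι → Rn n → ℝ≥0∞}
    (hf : ∀ i, AEMeasurable (f i) volume) (h0 : ∀ i, ∀ᵐ y, f i y ≠ 0) {e : ι → ℝ}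
    (he : ∀ i, 0 < e i) (hsum : ∑ i, e i = 1) (h1 : ∀ᵐ y, 1 ≤ ∏ i, f i y ^ e i) {C : ℝ≥0}
    (hC : ∀ (x : Rn n) (r : ℝ), 0 < r →
      ∏ i, (∫⁻ y in Metric.ball x r, f i y) ^ e i ≤ C * volume (Metric.ball x r)) (i : ι) :
    IsAInftyMeasure (volume.withDensity (f i)) := by
  classical
  -- The other factors of the product in `hC` do not vanish, so an infinite integral of `f i` would
  -- make the product infinite.
  have hfin : ∀ (x : Rn n) (r : ℝ), 0 < r → ∫⁻ y in Metric.ball x r, f i y ≠ ∞ := by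
    intro x r hr htop
    have h2 := hC x r hr
    rw [Finset.prod_eq_mul_prod_sdiff_singleton_of_mem (Finset.mem_univ i), htop,
      ENNReal.top_rpow_of_pos (he i), ENNReal.top_mul] at h2
    · exact absurd (top_le_iff.1 h2) (ENNReal.mul_ne_top ENNReal.coe_ne_top
        measure_ball_lt_top.ne)
    · refine Finset.prod_ne_zero_iff.2 fun j _ => ?_
      have := setLIntegral_ball_ne_zero (hf j) (h0 j) x hr
      simp [ENNReal.rpow_eq_zero_iff, this, (he j).not_gt]
  refine ⟨withDensity_absolutelyContinuous _ _, fun x r => ?_, C ^ (1 / e i), 1 / e i,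
    (one_div_pos.2 (he i)).le, fun x r hr F hF hFm => ?_⟩
  · rw [withDensity_apply _ measurableSet_ball]
    rcases lt_or_ge 0 r with hr | hr
    · exact (hfin x r hr).lt_top
    · simp [Metric.ball_eq_empty.2 hr]
  · rw [withDensity_apply _ measurableSet_ball, withDensity_apply _ hFm]
    set B := Metric.ball x r
    -- Hölder on $F$ bounds $|F|$ by the product of the integrals over $F$. Enlarging $F$ to $B$ in
    -- every factor but the `i`-th and multiplying by the missing factor over $B$ completes the
    -- product that `hC` controls. The power $1/e_i$ of this is the comparison.
    have h2 : volume F * (∫⁻ y in B, f i y) ^ e i ≤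
        C * (volume B * (∫⁻ y in F, f i y) ^ e i) := by
      calc volume F * (∫⁻ y in B, f i y) ^ e i
          ≤ (∏ j, (∫⁻ y in F, f j y) ^ e j) * (∫⁻ y in B, f i y) ^ e i := by
            gcongr
            exact measure_le_prod_lintegral_rpow hf (fun j => (he j).le) hsum h1 F
        _ = (∫⁻ y in F, f i y) ^ e i * ((∫⁻ y in B, f i y) ^ e i *
              ∏ j ∈ Finset.univ \ {i}, (∫⁻ y in F, f j y) ^ e j) := by
            rw [Finset.prod_eq_mul_prod_sdiff_singleton_of_mem (Finset.mem_univ i)]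
            ring
        _ ≤ (∫⁻ y in F, f i y) ^ e i * ((∫⁻ y in B, f i y) ^ e i *
              ∏ j ∈ Finset.univ \ {i}, (∫⁻ y in B, f j y) ^ e j) := by
            gcongr with j hj
            exact (he j).le
        _ = (∫⁻ y in F, f i y) ^ e i * ∏ j, (∫⁻ y in B, f j y) ^ e j := by
            rw [Finset.prod_eq_mul_prod_sdiff_singleton_of_mem (Finset.mem_univ i)
              (fun j => (∫⁻ y in B, f j y) ^ e j)]
        _ ≤ (∫⁻ y in F, f i y) ^ e i * (C * volume B) := by
            gcongr
            exact hC x r hr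
        _ = _ := by ring
    have h3 := ENNReal.rpow_le_rpow h2 (one_div_pos.2 (he i)).le
    rw [ENNReal.mul_rpow_of_nonneg _ _ (one_div_pos.2 (he i)).le,
      ENNReal.mul_rpow_of_nonneg _ _ (one_div_pos.2 (he i)).le,
      ENNReal.mul_rpow_of_nonneg _ _ (one_div_pos.2 (he i)).le, ← ENNReal.rpow_mul,
      ← ENNReal.rpow_mul, mul_one_div_cancel (he i).ne', ENNReal.rpow_one, ENNReal.rpow_one] at h3
    rwa [ENNReal.coe_rpow_of_nonneg _ (one_div_pos.2 (he i)).le]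

/-- This clears the volumes from Muckenhoupt conditions stated with averages. -/
theorem prod_rpow_le_of_prod_div_rpow_le {ι : Type*} (s : Finset ι) {a : ι → ℝ≥0∞} {v C : ℝ≥0∞}
    (h0 : v ≠ 0) (h1 : v ≠ ∞) {e : ι → ℝ} (he : ∀ i ∈ s, 0 ≤ e i)
    (h : ∏ i ∈ s, (a i / v) ^ e i ≤ C) : ∏ i ∈ s, a i ^ e i ≤ C * v ^ ∑ i ∈ s, e i := by
  calc ∏ i ∈ s, a i ^ e i = (∏ i ∈ s, (a i / v) ^ e i) * ∏ i ∈ s, v ^ e i := by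
        rw [← Finset.prod_mul_distrib]
        refine Finset.prod_congr rfl fun i hi => ?_
        rw [← ENNReal.mul_rpow_of_nonneg _ _ (he i hi), ENNReal.div_mul_cancel h0 h1]
    _ ≤ _ := by
        rw [prod_rpow_eq_rpow_sum s h0 h1]
        gcongr

theorem IsWeight.aemeasurable {n : ℕ} {ω : Rn n → ℝ} (hω : IsWeight ω) :
    AEMeasurable (fun y => ENNReal.ofReal (ω y)) volume :=
  hω.locallyIntegrable.aestronglyMeasurable.aemeasurable.ennreal_ofReal

theorem IsWeight.wMeas_ball_ne_zero {n : ℕ} {ω : Rn n → ℝ} (hω : IsWeight ω) (x : Rn n) {r : ℝ}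
    (hr : 0 < r) : wMeas ω (Metric.ball x r) ≠ 0 :=
  setLIntegral_ball_ne_zero hω.aemeasurable (hω.pos_ae.mono fun y hy => by simpa using hy) x hr

theorem IsWeight.wMeas_ball_ne_top {n : ℕ} {ω : Rn n → ℝ} (hω : IsWeight ω) (x : Rn n) (r : ℝ) :
    wMeas ω (Metric.ball x r) ≠ ∞ := by
  have h := integrableOn_ball_of_locallyIntegrable hω.locallyIntegrable x r
  have h2 := h.2
  rw [hasFiniteIntegral_iff_ofReal (ae_of_all _ hω.nonneg)] at h2
  exact h2.ne

/-- On a ball, $\omega^{-1}$ is almost everywhere at most the reciprocal of the essential infimum.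
This reduces $A_\infty$ to classes with $q>1$. -/
theorem IsMuckenhouptOne.isMuckenhoupt_two {n : ℕ} {ω : Rn n → ℝ} (h : IsMuckenhouptOne ω) :
    IsMuckenhoupt 2 ω := by
  obtain ⟨hω, C, hC⟩ := h
  refine ⟨hω, C, fun x r hr => ?_⟩
  have e1 : (2 - 1 : ℝ) = 1 := by norm_num
  rw [e1, ENNReal.rpow_one, div_one]
  set E := essInf (fun y => ENNReal.ofReal (ω y)) (volume.restrict (Metric.ball x r)) with hE
  have h5 : volume (Metric.ball x r) ≠ 0 := (Metric.measure_ball_pos _ _ hr).ne'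
  have h6 : volume (Metric.ball x r) ≠ ∞ := measure_ball_lt_top.ne
  have h2 : (ballAvg x r fun y => ENNReal.ofReal (ω y) ^ (-1 : ℝ)) ≤ E⁻¹ := by
    rw [ballAvg]
    refine ENNReal.div_le_of_le_mul ?_
    calc _ ≤ ∫⁻ y in Metric.ball x r, E⁻¹ := by
          refine lintegral_mono_ae ?_
          filter_upwards [ae_essInf_le (f := fun y => ENNReal.ofReal (ω y))
            (μ := volume.restrict (Metric.ball x r))] with y hy
          rw [ENNReal.rpow_neg_one]
          exact ENNReal.inv_le_inv.2 hy
      _ = _ := by simp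
  calc _ ≤ (C * E) * E⁻¹ := mul_le_mul' (hC x r hr) h2
    _ = C * (E * E⁻¹) := mul_assoc _ _ _
    _ ≤ C * 1 := by gcongr; exact ENNReal.mul_inv_le_one E
    _ = C := mul_one _

theorem IsAInfty.exists_isMuckenhoupt {n : ℕ} {ω : Rn n → ℝ} (h : IsAInfty ω) :
    ∃ q : ℝ, 1 < q ∧ IsMuckenhoupt q ω := by
  rcases h with h | h
  · exact ⟨2, one_lt_two, h.isMuckenhoupt_two⟩
  · exact h

theorem IsMuckenhoupt.exists_lintegral_mul_le {n : ℕ} {ω : Rn n → ℝ} {q : ℝ}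
    (hq : 1 < q) (h : IsMuckenhoupt q ω) : ∃ C : ℝ≥0, ∀ (x : Rn n) (r : ℝ), 0 < r →
      wMeas ω (Metric.ball x r) *
        (∫⁻ y in Metric.ball x r, ENNReal.ofReal (ω y) ^ (-(1 / (q - 1)))) ^ (q - 1) ≤
          C * volume (Metric.ball x r) ^ q := by
  obtain ⟨-, C, hC⟩ := h
  refine ⟨C, fun x r hr => ?_⟩
  have h := prod_rpow_le_of_prod_div_rpow_le Finset.univ
    (a := ![wMeas ω (Metric.ball x r),
      ∫⁻ y in Metric.ball x r, ENNReal.ofReal (ω y) ^ (-(1 / (q - 1)))])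
    (C := C) (e := ![1, q - 1]) (Metric.measure_ball_pos volume x hr).ne'
    measure_ball_lt_top.ne (by
      intro i _
      fin_cases i
      · simp
      · simpa using hq.le) (by simpa [Fin.prod_univ_two, ballAvg, wMeas] using hC x r hr)
  simpa [Fin.prod_univ_two, Fin.sum_univ_two] using h

/-- The weight $\omega$ and its dual $\omega^{-1/(q-1)}$, with exponents $1/q$ and $(q-1)/q$, have
geometric mean one, and the $A_q$ condition bounds the geometric mean of their averages. -/
theorem IsAInfty.isAInftyMeasure {n : ℕ} {ω : Rn n → ℝ} (h : IsAInfty ω) :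
    IsAInftyMeasure (volume.withDensity fun y => ENNReal.ofReal (ω y)) := by
  obtain ⟨q, hq, h⟩ := h.exists_isMuckenhoupt
  obtain ⟨C, hC⟩ := h.exists_lintegral_mul_le hq
  have hω := h.1
  have hq0 : 0 < q := by linarith
  refine isAInftyMeasure_withDensity (f := ![fun y => ENNReal.ofReal (ω y),
    fun y => ENNReal.ofReal (ω y) ^ (-(1 / (q - 1)))]) (e := ![1 / q, (q - 1) / q])
    (C := C ^ (1 / q)) ?_ ?_ ?_ ?_ ?_ ?_ 0
  · intro i
    fin_cases i
    · exact hω.aemeasurable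
    · exact hω.aemeasurable.pow_const _
  · intro i
    filter_upwards [hω.pos_ae] with y hy
    fin_cases i
    · simpa using hy
    · simp [ENNReal.rpow_eq_zero_iff, hy.not_ge]
  · intro i
    fin_cases i
    · simpa using hq0
    · exact div_pos (by linarith) hq0
  · rw [Fin.sum_univ_two]
    simp only [Matrix.cons_val_zero, Matrix.cons_val_one]
    field_simp
    ring
  · filter_upwards [hω.pos_ae] with y hy
    have h0 : ENNReal.ofReal (ω y) ≠ 0 := by simpa using hy
    simp only [Fin.prod_univ_two, Matrix.cons_val_zero, Matrix.cons_val_one]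
    rw [← ENNReal.rpow_mul, ← ENNReal.rpow_add _ _ h0 ENNReal.ofReal_ne_top]
    have : 1 / q + -(1 / (q - 1)) * ((q - 1) / q) = 0 := by
      have : q - 1 ≠ 0 := by linarith
      field_simp
      ring
    rw [this, ENNReal.rpow_zero]
  · intro x r hr
    simp only [Fin.prod_univ_two, Matrix.cons_val_zero, Matrix.cons_val_one]
    have h2 := ENNReal.rpow_le_rpow (hC x r hr) (one_div_pos.2 hq0).le
    rw [ENNReal.mul_rpow_of_nonneg _ _ (one_div_pos.2 hq0).le,
      ENNReal.mul_rpow_of_nonneg _ _ (one_div_pos.2 hq0).le, ← ENNReal.rpow_mul,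
      ← ENNReal.rpow_mul, mul_one_div_cancel hq0.ne', ENNReal.rpow_one, mul_one_div] at h2
    rwa [ENNReal.coe_rpow_of_nonneg _ (one_div_pos.2 hq0).le]

/-! ### Multiple weights -/

theorem one_div_conjExponent {P : ℝ} (hP : 1 < P) : 1 / P.conjExponent = 1 - 1 / P := by
  have h : P - 1 ≠ 0 := by linarith
  rw [Real.conjExponent]
  field_simp

theorem conjExponent_pos {P : ℝ} (hP : 1 < P) : 0 < P.conjExponent :=
  div_pos (by linarith) (by linarith)

theorem one_sub_conjExponent_mul {P : ℝ} (hP : 1 < P) :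
    (1 - P.conjExponent) * (1 / P.conjExponent) = -(1 / P) := by
  have h := (conjExponent_pos hP).ne'
  rw [sub_mul, one_mul, mul_one_div_cancel h, one_div_conjExponent hP]
  ring

theorem pos_of_one_div_eq_sum {m : ℕ} (hm : 0 < m) {P : Fin m → ℝ} (hP : ∀ k, 1 < P k) {p : ℝ}
    (hp : 1 / p = ∑ k, 1 / P k) : 0 < p := by
  rw [← one_div_pos, hp]
  have : Nonempty (Fin m) := ⟨⟨0, hm⟩⟩
  exact Finset.sum_pos (fun k _ => one_div_pos.2 (by linarith [hP k])) Finset.univ_nonempty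

theorem one_div_add_sum_conjExponent {m : ℕ} {P : Fin m → ℝ} (hP : ∀ k, 1 < P k) {p : ℝ}
    (hp : 1 / p = ∑ k, 1 / P k) : 1 / p + ∑ i, 1 / (P i).conjExponent = m := by
  rw [hp, ← Finset.sum_add_distrib]
  simp_rw [one_div_conjExponent (hP _)]
  simp

theorem IsMultipleWeight.exists_prod_le {n m : ℕ} (hm : 0 < m) {P : Fin m → ℝ}
    (hP : ∀ k, 1 < P k) {p : ℝ} (hp : 1 / p = ∑ k, 1 / P k) {ω : Fin m → Rn n → ℝ}
    (hω : IsMultipleWeight P p ω) : ∃ C : ℝ≥0, ∀ (x : Rn n) (r : ℝ), 0 < r →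
      (∫⁻ y in Metric.ball x r, ENNReal.ofReal (∏ i, ω i y ^ (p / P i))) ^ (1 / p) *
        ∏ i, (∫⁻ y in Metric.ball x r,
          ENNReal.ofReal (ω i y) ^ (1 - (P i).conjExponent)) ^ (1 / (P i).conjExponent) ≤
        C * volume (Metric.ball x r) ^ m := by
  obtain ⟨-, C, hC⟩ := hω
  have hp0 := pos_of_one_div_eq_sum hm hP hp
  refine ⟨C, fun x r hr => ?_⟩
  have h := prod_rpow_le_of_prod_div_rpow_le (ι := Option (Fin m)) Finset.univ
    (a := fun o => o.elim (∫⁻ y in Metric.ball x r, ENNReal.ofReal (∏ i, ω i y ^ (p / P i)))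
      fun i => ∫⁻ y in Metric.ball x r, ENNReal.ofReal (ω i y) ^ (1 - (P i).conjExponent))
    (C := C) (e := fun o => o.elim (1 / p) fun i => 1 / (P i).conjExponent)
    (Metric.measure_ball_pos volume x hr).ne' measure_ball_lt_top.ne (by
      rintro (_ | i) -
      · exact (one_div_pos.2 hp0).le
      · exact (one_div_pos.2 (conjExponent_pos (hP i))).le)
    (by simpa only [Fintype.prod_option, Option.elim, ballAvg] using hC x r hr)
  simp only [Fintype.prod_option, Fintype.sum_option, Option.elim] at h
  rwa [one_div_add_sum_conjExponent hP hp, ENNReal.rpow_natCast] at h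

theorem ofReal_prod_rpow {m : ℕ} {a e : Fin m → ℝ} (ha : ∀ i, 0 < a i) :
    ENNReal.ofReal (∏ i, a i ^ e i) = ∏ i, ENNReal.ofReal (a i) ^ e i := by
  rw [ENNReal.ofReal_prod_of_nonneg fun i _ => Real.rpow_nonneg (ha i).le _]
  exact Finset.prod_congr rfl fun i _ => (ENNReal.ofReal_rpow_of_pos (ha i)).symm

theorem aemeasurable_ofReal_prod_rpow {n m : ℕ} {ω : Fin m → Rn n → ℝ} (hω : ∀ i, IsWeight (ω i))
    (e : Fin m → ℝ) :
    AEMeasurable (fun y => ENNReal.ofReal (∏ i, ω i y ^ e i)) (volume : Measure (Rn n)) :=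
  (Finset.univ.aemeasurable_fun_prod fun i _ =>
    (hω i).locallyIntegrable.aestronglyMeasurable.aemeasurable.pow_const _).ennreal_ofReal

/-- The dual weights of a multiple weight are of class `A_∞`. -/
theorem IsMultipleWeight.isAInftyMeasure {n m : ℕ} (hm : 0 < m) {P : Fin m → ℝ}
    (hP : ∀ k, 1 < P k) {p : ℝ} (hp : 1 / p = ∑ k, 1 / P k) {ω : Fin m → Rn n → ℝ}
    (hω : IsMultipleWeight P p ω) (i : Fin m) :
    IsAInftyMeasure ((volume : Measure (Rn n)).withDensity fun y =>
      ENNReal.ofReal (ω i y) ^ (1 - (P i).conjExponent)) := by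
  obtain ⟨C, hC⟩ := hω.exists_prod_le hm hP hp
  have hp0 := pos_of_one_div_eq_sum hm hP hp
  have hm' : (0 : ℝ) < m := by exact_mod_cast hm
  have hpos : ∀ᵐ y, ∀ i, 0 < ω i y := ae_all_iff.2 fun i => (hω.1 i).pos_ae
  -- The $m+1$ functions are $\prod\omega_i^{p/p_i}$ at `none` and the dual weights at `some i`.
  -- Since $1/p+\sum 1/p_i'=m$, the exponents of $A_{\vec P}$ are divided by $m$ to sum to one.
  refine isAInftyMeasure_withDensity (ι := Option (Fin m))
    (f := fun o => o.elim (fun y => ENNReal.ofReal (∏ i, ω i y ^ (p / P i)))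
      fun i y => ENNReal.ofReal (ω i y) ^ (1 - (P i).conjExponent))
    (e := fun o => o.elim (1 / p / m) fun i => 1 / (P i).conjExponent / m)
    (C := C ^ (1 / (m : ℝ))) ?_ ?_ ?_ ?_ ?_ ?_ (some i)
  · rintro (_ | j)
    · exact aemeasurable_ofReal_prod_rpow hω.1 _
    · exact (hω.1 j).aemeasurable.pow_const _
  · rintro (_ | j)
    · filter_upwards [hpos] with y hy
      have : 0 < ∏ i, ω i y ^ (p / P i) := Finset.prod_pos fun i _ => Real.rpow_pos_of_pos (hy i) _
      simpa using this
    · filter_upwards [hpos] with y hy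
      simp [ENNReal.rpow_eq_zero_iff, (hy j).not_ge]
  · rintro (_ | j)
    · exact div_pos (one_div_pos.2 hp0) hm'
    · exact div_pos (one_div_pos.2 (conjExponent_pos (hP j))) hm'
  · simp only [Fintype.sum_option, Option.elim]
    rw [← Finset.sum_div, ← add_div, one_div_add_sum_conjExponent hP hp, div_self hm'.ne']
  · filter_upwards [hpos] with y hy
    simp only [Fintype.prod_option, Option.elim]
    rw [ofReal_prod_rpow hy, ← ENNReal.prod_rpow_of_nonneg
      (div_nonneg (one_div_pos.2 hp0).le hm'.le), ← Finset.prod_mul_distrib]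
    refine le_of_eq (Finset.prod_eq_one fun j _ => ?_).symm
    have h0 : ENNReal.ofReal (ω j y) ≠ 0 := by simpa using hy j
    rw [← ENNReal.rpow_mul, ← ENNReal.rpow_mul, ← ENNReal.rpow_add _ _ h0 ENNReal.ofReal_ne_top]
    have : p / P j * (1 / p / m) + (1 - (P j).conjExponent) * (1 / (P j).conjExponent / m) = 0 := by
      have e1 : p / P j * (1 / p / m) + (1 - (P j).conjExponent) * (1 / (P j).conjExponent / m) =
          (p * (1 / p) * (1 / P j) +
            (1 - (P j).conjExponent) * (1 / (P j).conjExponent)) / m := by ring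
      rw [e1, one_sub_conjExponent_mul (hP j), mul_one_div_cancel hp0.ne']
      ring
    rw [this, ENNReal.rpow_zero]
  · intro x r hr
    have hm1 : (0 : ℝ) ≤ 1 / m := (one_div_pos.2 hm').le
    have h2 := ENNReal.rpow_le_rpow (hC x r hr) hm1
    rw [ENNReal.mul_rpow_of_nonneg _ _ hm1, ENNReal.mul_rpow_of_nonneg _ _ hm1,
      ← ENNReal.prod_rpow_of_nonneg hm1, ← ENNReal.rpow_mul, ← ENNReal.rpow_natCast,
      ← ENNReal.rpow_mul, mul_one_div_cancel hm'.ne', ENNReal.rpow_one, mul_one_div] at h2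
    simp only [Fintype.prod_option, Option.elim]
    simp_rw [← ENNReal.rpow_mul, mul_one_div] at h2
    rwa [ENNReal.coe_rpow_of_nonneg _ hm1]

/-- For weights of class `A_∞` the geometric mean of the averages is controlled by the average
of the geometric mean. -/
theorem exists_prod_wMeas_rpow_le {n m : ℕ} {ω : Fin m → Rn n → ℝ}
    (hω : ∀ i, IsAInfty (ω i)) {θ : Fin m → ℝ} (hθ : ∀ i, 0 ≤ θ i) (hsum : ∑ i, θ i = 1) :
    ∃ C : ℝ≥0, ∀ (x : Rn n) (r : ℝ), 0 < r → ∏ i, wMeas (ω i) (Metric.ball x r) ^ θ i ≤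
      C * ∫⁻ y in Metric.ball x r, ENNReal.ofReal (∏ i, ω i y ^ θ i) := by
  choose q hq hqω using fun i => (hω i).exists_isMuckenhoupt
  choose C hC using fun i => (hqω i).exists_lintegral_mul_le (hq i)
  have hpos : ∀ᵐ y, ∀ i, 0 < ω i y := ae_all_iff.2 fun i => (hqω i).1.pos_ae
  have hq' : ∀ i, 0 < q i - 1 := fun i => by linarith [hq i]
  -- This normalises Hölder's inequality for $\prod\omega_i^{\theta_i}$ and the duals
  -- $\omega_i^{-1/(q_i-1)}$ with exponents $1/d$ and $\theta_i(q_i-1)/d$, whose pointwise product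
  -- is one. As $\sum\theta_i=1$, also $d=\sum\theta_iq_i$, the power of the volume in the product
  -- of the $A_{q_i}$ conditions, so the volumes cancel.
  set d : ℝ := 1 + ∑ i, θ i * (q i - 1) with hd
  have hd0 : 0 < d := by
    have : 0 ≤ ∑ i, θ i * (q i - 1) :=
      Finset.sum_nonneg fun i _ => mul_nonneg (hθ i) (hq' i).le
    linarith
  refine ⟨∏ i, C i ^ θ i, fun x r hr => ?_⟩
  set V := volume (Metric.ball x r) with hV
  have hV0 : V ≠ 0 := (Metric.measure_ball_pos volume x hr).ne'
  have hV1 : V ≠ ∞ := measure_ball_lt_top.ne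
  set N := ∫⁻ y in Metric.ball x r, ENNReal.ofReal (∏ i, ω i y ^ θ i) with hN
  set t : Fin m → ℝ≥0∞ := fun i =>
    ∫⁻ y in Metric.ball x r, ENNReal.ofReal (ω i y) ^ (-(1 / (q i - 1))) with ht
  have h1 : V ≤ N ^ (1 / d) * ∏ i, t i ^ (θ i * (q i - 1) / d) := by
    have := measure_le_prod_lintegral_rpow (ι := Option (Fin m)) (μ := (volume : Measure (Rn n)))
      (f := fun o => o.elim (fun y => ENNReal.ofReal (∏ i, ω i y ^ θ i))
        fun i y => ENNReal.ofReal (ω i y) ^ (-(1 / (q i - 1))))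
      (e := fun o => o.elim (1 / d) fun i => θ i * (q i - 1) / d) ?_ ?_ ?_ ?_ (Metric.ball x r)
    · simpa only [Fintype.prod_option, Option.elim] using this
    · rintro (_ | j)
      · exact aemeasurable_ofReal_prod_rpow (fun i => (hqω i).1) _
      · exact (hqω j).1.aemeasurable.pow_const _
    · rintro (_ | j)
      · exact (one_div_pos.2 hd0).le
      · exact div_nonneg (mul_nonneg (hθ j) (hq' j).le) hd0.le
    · simp only [Fintype.sum_option, Option.elim]
      rw [← Finset.sum_div, ← add_div, ← hd, div_self hd0.ne']
    · filter_upwards [hpos] with y hy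
      simp only [Fintype.prod_option, Option.elim]
      rw [ofReal_prod_rpow hy, ← ENNReal.prod_rpow_of_nonneg (one_div_pos.2 hd0).le,
        ← Finset.prod_mul_distrib]
      refine le_of_eq (Finset.prod_eq_one fun j _ => ?_).symm
      have h0 : ENNReal.ofReal (ω j y) ≠ 0 := by simpa using hy j
      rw [← ENNReal.rpow_mul, ← ENNReal.rpow_mul, ← ENNReal.rpow_add _ _ h0 ENNReal.ofReal_ne_top]
      have : θ j * (1 / d) + -(1 / (q j - 1)) * (θ j * (q j - 1) / d) = 0 := by
        have := (hq' j).ne'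
        field_simp
        ring
      rw [this, ENNReal.rpow_zero]
  have h2 : V ^ d ≤ N * ∏ i, t i ^ (θ i * (q i - 1)) := by
    have := ENNReal.rpow_le_rpow h1 hd0.le
    rw [ENNReal.mul_rpow_of_nonneg _ _ hd0.le, ← ENNReal.prod_rpow_of_nonneg hd0.le,
      ← ENNReal.rpow_mul, one_div_mul_cancel hd0.ne', ENNReal.rpow_one] at this
    simpa only [← ENNReal.rpow_mul, div_mul_cancel₀ _ hd0.ne'] using this
  have h3 : (∏ i, wMeas (ω i) (Metric.ball x r) ^ θ i) * V ^ d ≤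
      (∏ i, C i ^ θ i : ℝ≥0) * N * V ^ d := by
    calc (∏ i, wMeas (ω i) (Metric.ball x r) ^ θ i) * V ^ d
        ≤ (∏ i, wMeas (ω i) (Metric.ball x r) ^ θ i) *
          (N * ∏ i, t i ^ (θ i * (q i - 1))) := by
          gcongr
      _ = N * ∏ i, (wMeas (ω i) (Metric.ball x r) * t i ^ (q i - 1)) ^ θ i := by
          rw [mul_left_comm, ← Finset.prod_mul_distrib]
          congr 1
          refine Finset.prod_congr rfl fun i _ => ?_
          rw [ENNReal.mul_rpow_of_nonneg _ _ (hθ i), ← ENNReal.rpow_mul, mul_comm (q i - 1)]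
      _ ≤ N * ∏ i, (C i * V ^ q i) ^ θ i := by
          refine mul_le_mul_right (Finset.prod_le_prod' fun i _ => ?_) _
          exact ENNReal.rpow_le_rpow (hC i x r hr) (hθ i)
      _ = N * ((∏ i, C i ^ θ i : ℝ≥0) * V ^ d) := by
          congr 1
          have e1 : ∀ i, (C i * V ^ q i) ^ θ i = (C i ^ θ i : ℝ≥0) * V ^ (q i * θ i) := fun i => by
            rw [ENNReal.mul_rpow_of_nonneg _ _ (hθ i), ENNReal.coe_rpow_of_nonneg _ (hθ i),
              ← ENNReal.rpow_mul]
          simp_rw [e1]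
          rw [Finset.prod_mul_distrib, prod_rpow_eq_rpow_sum _ hV0 hV1]
          have e2 : ∑ i, q i * θ i = d := by
            have e3 : d = ∑ i, θ i + ∑ i, θ i * (q i - 1) := by rw [hsum]
            rw [e3, ← Finset.sum_add_distrib]
            exact Finset.sum_congr rfl fun i _ => by ring
          rw [e2]
          push_cast
          rfl
      _ = _ := by ring
  have hVd0 : V ^ d ≠ 0 := by simp [ENNReal.rpow_eq_zero_iff, hV0, hV1]
  have hVd1 : V ^ d ≠ ∞ := ENNReal.rpow_ne_top_of_nonneg hd0.le hV1
  exact (ENNReal.mul_le_mul_iff_left hVd0 hVd1).1 h3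

/-- The normalisation of the weights and their dual weights over balls. -/
theorem IsMultipleWeight.exists_prod_wMeas_mul_le {n m : ℕ} (hm : 0 < m) {P : Fin m → ℝ}
    (hP : ∀ k, 1 < P k) {p : ℝ} (hp : 1 / p = ∑ k, 1 / P k) {ω : Fin m → Rn n → ℝ}
    (hω : IsMultipleWeight P p ω) (hω' : ∀ i, IsAInfty (ω i)) :
    ∃ C : ℝ≥0, ∀ (x : Rn n) (r : ℝ), 0 < r →
      (∏ i, wMeas (ω i) (Metric.ball x r) ^ (1 / P i)) *
        ∏ i, (∫⁻ y in Metric.ball x r,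
          ENNReal.ofReal (ω i y) ^ (1 - (P i).conjExponent)) ^ (1 / (P i).conjExponent) ≤
        C * volume (Metric.ball x r) ^ m := by
  have hp0 := pos_of_one_div_eq_sum hm hP hp
  have hP0 : ∀ i, 0 < P i := fun i => by linarith [hP i]
  obtain ⟨C, hC⟩ := hω.exists_prod_le hm hP hp
  -- $A_{\vec P}$ controls only the weight $\prod\omega_i^{p/p_i}$; with $\theta_i=p/p_i$, which sum
  -- to one, its mass on a ball dominates the separate masses $\omega_i(B)$ to the powers
  -- $\theta_i$.
  obtain ⟨C', hC'⟩ := exists_prod_wMeas_rpow_le hω' (θ := fun i => p / P i)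
    (fun i => (div_pos hp0 (hP0 i)).le) (by
      simp_rw [div_eq_mul_one_div p]
      rw [← Finset.mul_sum, ← hp, mul_one_div_cancel hp0.ne'])
  have hp1 := (one_div_pos.2 hp0).le
  refine ⟨C' ^ (1 / p) * C, fun x r hr => ?_⟩
  have h := ENNReal.rpow_le_rpow (hC' x r hr) hp1
  rw [← ENNReal.prod_rpow_of_nonneg hp1, ENNReal.mul_rpow_of_nonneg _ _ hp1] at h
  have e1 : ∀ i, p / P i * (1 / p) = 1 / P i := fun i => by field_simp
  simp_rw [← ENNReal.rpow_mul, e1] at h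
  calc _ ≤ _ := mul_le_mul_left h _
    _ = (C' : ℝ≥0∞) ^ (1 / p) * _ := mul_assoc _ _ _
    _ ≤ (C' : ℝ≥0∞) ^ (1 / p) * _ := mul_le_mul_right (hC x r hr) _
    _ = _ := by
      rw [ENNReal.coe_mul, ENNReal.coe_rpow_of_nonneg _ hp1, mul_assoc]

/-! ### Oscillation at different scales -/

theorem volume_ball_eq {n : ℕ} (x : Rn n) {t : ℝ} (ht : 0 < t) :
    volume (Metric.ball x t) = ENNReal.ofReal t ^ n * volume (Metric.ball (0 : Rn n) 1) := by
  rw [Measure.addHaar_ball_of_pos _ _ ht, finrank_euclideanSpace, Fintype.card_fin,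
    ENNReal.ofReal_pow ht.le]

/-- The averages of a function of bounded mean oscillation over concentric balls differ at most
logarithmically. -/
theorem IsBMO.exists_enorm_average_sub_le {n : ℕ} {𝕜 : Type*} [RCLike 𝕜] {b : Rn n → 𝕜}
    (hb : IsBMO b) : ∃ C : ℝ≥0, ∀ (x : Rn n) (r t : ℝ), 0 < r → r ≤ t →
      ‖(⨍ y in Metric.ball x t, b y) - ⨍ y in Metric.ball x r, b y‖ₑ ≤
        C * ENNReal.ofReal (1 + Real.log (t / r)) := by
  obtain ⟨A, -, hA⟩ := hb.exists_lintegral_le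
  have step : ∀ (x : Rn n) (r t : ℝ), 0 < r → r ≤ t → t ≤ 2 * r →
      ‖(⨍ y in Metric.ball x t, b y) - ⨍ y in Metric.ball x r, b y‖ₑ ≤ A * (2 ^ n : ℝ≥0) := by
    intro x r t hr hrt ht
    have ht0 : 0 < t := hr.trans_le hrt
    rw [enorm_sub_rev]
    refine enorm_average_sub_average_le hb.1 ht0 (hA x t ht0) (Metric.ball_subset_ball hrt) ?_
    rw [volume_ball_eq x ht0, volume_ball_eq x hr, ← mul_assoc]
    gcongr
    rw [ENNReal.coe_pow, ← mul_pow]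
    gcongr
    have : ((2 : ℝ≥0) : ℝ≥0∞) = ENNReal.ofReal 2 := by simp
    rw [this, ← ENNReal.ofReal_mul zero_le_two]
    exact ENNReal.ofReal_le_ofReal ht
  have iter : ∀ (k : ℕ) (x : Rn n) (r t : ℝ), 0 < r → r ≤ t → t ≤ 2 ^ k * r →
      ‖(⨍ y in Metric.ball x t, b y) - ⨍ y in Metric.ball x r, b y‖ₑ ≤
        k * (A * (2 ^ n : ℝ≥0)) := by
    intro k
    induction k with
    | zero =>
      intro x r t hr hrt ht
      have : t = r := le_antisymm (by simpa using ht) hrt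
      simp [this]
    | succ k ih =>
      intro x r t hr hrt ht
      rw [Nat.cast_succ, add_mul, one_mul]
      rcases le_total t (2 * r) with h | h
      · exact (step x r t hr hrt h).trans le_add_self
      -- One doubling is peeled off at the outer radius.
      · have h1 := ih x r (t / 2) hr (by linarith) (by rw [pow_succ] at ht; linarith)
        have h2 := step x (t / 2) t (by linarith) (by linarith) (by linarith)
        rw [← sub_add_sub_cancel _ (⨍ y in Metric.ball x (t / 2), b y), add_comm]
        exact (enorm_add_le _ _).trans (add_le_add h1 h2)
  -- Each doubling costs $2^nA$, and $\lceil\log_2(t/r)\rceil\le 2(1+\log(t/r))$ because $\log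
  -- 2>1/2$.
  refine ⟨2 * (A * 2 ^ n), fun x r t hr hrt => ?_⟩
  have htr : 1 ≤ t / r := (one_le_div hr).2 hrt
  have hlog : 0 ≤ Real.log (t / r) := Real.log_nonneg htr
  have hl2 : (1 / 2 : ℝ) < Real.log 2 := by linarith [Real.log_two_gt_d9]
  set k := ⌈Real.log (t / r) / Real.log 2⌉₊ with hk
  have hk1 : Real.log (t / r) / Real.log 2 ≤ k := Nat.le_ceil _
  have hk2 : (k : ℝ) < Real.log (t / r) / Real.log 2 + 1 :=
    Nat.ceil_lt_add_one (div_nonneg hlog (by linarith))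
  have ht : t ≤ 2 ^ k * r := by
    rw [← div_le_iff₀ hr, ← Real.log_le_log_iff (by linarith) (by positivity), Real.log_pow]
    exact (div_le_iff₀ (by linarith)).1 hk1
  have hk3 : (k : ℝ) ≤ 2 * (1 + Real.log (t / r)) := by
    have : Real.log (t / r) / Real.log 2 ≤ 2 * Real.log (t / r) := by
      rw [div_le_iff₀ (by linarith)]
      nlinarith
    linarith
  refine (iter k x r t hr hrt ht).trans ?_
  calc (k : ℝ≥0∞) * (A * (2 ^ n : ℝ≥0))
      ≤ (2 * ENNReal.ofReal (1 + Real.log (t / r))) * (A * (2 ^ n : ℝ≥0)) := by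
        gcongr
        have : (2 : ℝ≥0∞) = ENNReal.ofReal 2 := by simp
        rw [this, ← ENNReal.ofReal_mul zero_le_two, ← ENNReal.ofReal_natCast]
        exact ENNReal.ofReal_le_ofReal hk3
    _ = _ := by push_cast; ring

/-! ### Weighted Hölder inequality -/

/-- Hölder's inequality after inserting $\omega^{1/P}\omega^{-1/P}=1$; the second factor raised to
the power $P'$ is the dual weight $\omega^{1-P'}$. -/
theorem lintegral_mul_enorm_le_wLpNorm {n : ℕ} {𝕜 : Type*} [RCLike 𝕜] {P : ℝ} (hP : 1 < P)
    {ω : Rn n → ℝ} (hω : IsWeight ω) {a : Rn n → ℝ≥0∞} (ha : AEMeasurable a volume)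
    {f : Rn n → 𝕜} (hf : AEStronglyMeasurable f volume) (s : Set (Rn n)) :
    ∫⁻ y in s, a y * ‖f y‖ₑ ≤ wLpNorm P ω s f *
      (∫⁻ y in s, ENNReal.ofReal (ω y) ^ (1 - P.conjExponent) * a y ^ P.conjExponent) ^
        (1 / P.conjExponent) := by
  have hP0 : 0 < P := by linarith
  have hP' := conjExponent_pos hP
  have hpq : P.HolderConjugate P.conjExponent := Real.HolderConjugate.conjExponent hP
  have h := ENNReal.lintegral_mul_le_Lp_mul_Lq (volume.restrict s) hpq
    (f := fun y => ‖f y‖ₑ * ENNReal.ofReal (ω y) ^ (1 / P))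
    (g := fun y => ENNReal.ofReal (ω y) ^ (-(1 / P)) * a y)
    (hf.enorm.mul (hω.aemeasurable.pow_const _)).restrict
    ((hω.aemeasurable.pow_const _).mul ha).restrict
  have e1 : ∀ y, (‖f y‖ₑ * ENNReal.ofReal (ω y) ^ (1 / P)) ^ P =
      ‖f y‖ₑ ^ P * ENNReal.ofReal (ω y) := fun y => by
    rw [ENNReal.mul_rpow_of_nonneg _ _ hP0.le, ← ENNReal.rpow_mul, one_div_mul_cancel hP0.ne',
      ENNReal.rpow_one]
  have e2 : ∀ y, (ENNReal.ofReal (ω y) ^ (-(1 / P)) * a y) ^ P.conjExponent =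
      ENNReal.ofReal (ω y) ^ (1 - P.conjExponent) * a y ^ P.conjExponent := fun y => by
    rw [ENNReal.mul_rpow_of_nonneg _ _ hP'.le, ← ENNReal.rpow_mul, ← one_sub_conjExponent_mul hP,
      mul_assoc, one_div_mul_cancel hP'.ne', mul_one]
  simp_rw [e1, e2] at h
  refine le_trans (lintegral_mono_ae ?_) h
  filter_upwards [ae_restrict_of_ae hω.pos_ae] with y hy
  have h0 : ENNReal.ofReal (ω y) ≠ 0 := by simpa using hy
  have h3 : ENNReal.ofReal (ω y) ^ (1 / P) * ENNReal.ofReal (ω y) ^ (-(1 / P)) = 1 := by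
    rw [← ENNReal.rpow_add _ _ h0 ENNReal.ofReal_ne_top, add_neg_cancel, ENNReal.rpow_zero]
  apply le_of_eq
  simp only [Pi.mul_apply]
  calc a y * ‖f y‖ₑ = a y * ‖f y‖ₑ *
        (ENNReal.ofReal (ω y) ^ (1 / P) * ENNReal.ofReal (ω y) ^ (-(1 / P))) := by
        rw [h3, mul_one]
    _ = _ := by ring

/-- The local integrals of `(U + |b - b_B|) |f|` over the balls that are concentric with `B`. -/
theorem exists_lintegral_oscillation_mul_le {n : ℕ} {𝕜 : Type*} [RCLike 𝕜] {P : ℝ} (hP : 1 < P)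
    {ω : Rn n → ℝ} (hω : IsWeight ω)
    (hσ : IsAInftyMeasure ((volume : Measure (Rn n)).withDensity fun y =>
      ENNReal.ofReal (ω y) ^ (1 - P.conjExponent)))
    {b : Rn n → 𝕜} (hb : IsBMO b) : ∃ C : ℝ≥0, ∀ (x : Rn n) (r t : ℝ), 0 < r → r ≤ t →
      ∀ (U : ℝ≥0∞), 1 ≤ U → ∀ f : Rn n → 𝕜, AEStronglyMeasurable f volume →
        ∫⁻ y in Metric.ball x t, (U + ‖b y - ⨍ z in Metric.ball x r, b z‖ₑ) * ‖f y‖ₑ ≤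
          C * (U * ENNReal.ofReal (1 + Real.log (t / r)) * wLpNorm P ω (Metric.ball x t) f *
            (∫⁻ y in Metric.ball x t, ENNReal.ofReal (ω y) ^ (1 - P.conjExponent)) ^
              (1 / P.conjExponent)) := by
  have hP' := conjExponent_pos hP
  have hP1 := (one_div_pos.2 hP').le
  obtain ⟨C₁, hC₁⟩ := hb.exists_enorm_average_sub_le
  obtain ⟨C₂, hC₂⟩ := hσ.exists_lintegral_rpow_le hb hP'
  refine ⟨(1 + C₁) * C₂ ^ (1 / P.conjExponent), fun x r t hr hrt U hU f hf => ?_⟩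
  have ht : 0 < t := hr.trans_le hrt
  set ℓ := ENNReal.ofReal (1 + Real.log (t / r)) with hℓ
  have hℓ1 : 1 ≤ ℓ := by
    rw [hℓ, ← ENNReal.ofReal_one]
    exact ENNReal.ofReal_le_ofReal
      (le_add_of_nonneg_right (Real.log_nonneg ((one_le_div hr).2 hrt)))
  set B := Metric.ball x t with hB
  set a : Rn n → ℝ≥0∞ := fun y => 1 + ‖b y - ⨍ z in B, b z‖ₑ with ha
  have hbm := hb.1.aestronglyMeasurable
  have ham : AEMeasurable a volume :=
    aemeasurable_const.add (hbm.sub aestronglyMeasurable_const).enorm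
  -- With $U,\ell\ge1$ the sum of the three contributions is dominated by a product, in which only
  -- `a` depends on `y`. Recentring from the small ball to `B` costs the logarithm.
  have h1 : ∀ y, U + ‖b y - ⨍ z in Metric.ball x r, b z‖ₑ ≤ (1 + C₁) * (U * ℓ * a y) := by
    intro y
    have h2 : ‖b y - ⨍ z in Metric.ball x r, b z‖ₑ ≤ ‖b y - ⨍ z in B, b z‖ₑ + C₁ * ℓ := by
      rw [← sub_add_sub_cancel _ (⨍ z in B, b z)]
      exact (enorm_add_le _ _).trans (add_le_add_right (hC₁ x r t hr hrt) _)
    have h3 : 1 ≤ U * ℓ := one_le_mul hU hℓ1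
    calc U + ‖b y - ⨍ z in Metric.ball x r, b z‖ₑ
        ≤ U + (‖b y - ⨍ z in B, b z‖ₑ + C₁ * ℓ) := by gcongr
      _ ≤ U * ℓ + (U * ℓ * ‖b y - ⨍ z in B, b z‖ₑ + C₁ * (U * ℓ)) := by
          gcongr
          · exact le_mul_of_one_le_right' hℓ1
          · exact le_mul_of_one_le_left' h3
          · exact le_mul_of_one_le_left' hU
      _ = U * ℓ * a y + C₁ * (U * ℓ) * 1 := by rw [ha]; ring
      _ ≤ U * ℓ * a y + C₁ * (U * ℓ) * a y := by
          gcongr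
          exact le_self_add
      _ = _ := by ring
  have h4 : (∫⁻ y in B, ENNReal.ofReal (ω y) ^ (1 - P.conjExponent) * a y ^ P.conjExponent) ^
      (1 / P.conjExponent) ≤ (C₂ ^ (1 / P.conjExponent) : ℝ≥0) *
      (∫⁻ y in B, ENNReal.ofReal (ω y) ^ (1 - P.conjExponent)) ^ (1 / P.conjExponent) := by
    rw [ENNReal.coe_rpow_of_nonneg _ hP1, ← ENNReal.mul_rpow_of_nonneg _ _ hP1]
    refine ENNReal.rpow_le_rpow ?_ hP1
    have := hC₂ x t ht
    rw [withDensity_apply _ measurableSet_ball, restrict_withDensity measurableSet_ball,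
      lintegral_withDensity_eq_lintegral_mul₀ (hω.aemeasurable.pow_const _).restrict
        (ham.pow_const _).restrict] at this
    exact this
  calc _ ≤ ∫⁻ y in B, (1 + C₁) * (U * ℓ) * (a y * ‖f y‖ₑ) := by
        refine lintegral_mono fun y => ?_
        calc _ ≤ (1 + C₁) * (U * ℓ * a y) * ‖f y‖ₑ := by gcongr; exact h1 y
          _ = _ := by ring
    _ = (1 + C₁) * (U * ℓ) * ∫⁻ y in B, a y * ‖f y‖ₑ :=
        lintegral_const_mul'' _ (ham.mul hf.enorm).restrict
    _ ≤ (1 + C₁) * (U * ℓ) * (wLpNorm P ω B f * ((C₂ ^ (1 / P.conjExponent) : ℝ≥0) *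
        (∫⁻ y in B, ENNReal.ofReal (ω y) ^ (1 - P.conjExponent)) ^ (1 / P.conjExponent))) := by
        gcongr
        exact (lintegral_mul_enorm_le_wLpNorm hP hω ham hf B).trans (by gcongr)
    _ = _ := by push_cast; ring

/-! ### The multilinear kernel -/

/-- Tonelli's theorem, splitting off the variable with index zero. -/
theorem lintegral_fin_prod_eq_prod {X : Type*} [MeasurableSpace X] (μ : Measure X) [SigmaFinite μ] :
    ∀ {m : ℕ} {g : Fin m → X → ℝ≥0∞}, (∀ i, Measurable (g i)) →
      ∫⁻ y : Fin m → X, ∏ i, g i (y i) ∂(Measure.pi fun _ => μ) = ∏ i, ∫⁻ z, g i z ∂μ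
  | 0, g, _ => by simp
  | m + 1, g, hg => by
    have h := (measurePreserving_piFinSuccAbove (fun _ : Fin (m + 1) => μ) 0).symm
    rw [← h.lintegral_comp_emb (MeasurableEquiv.measurableEmbedding _)]
    simp_rw [MeasurableEquiv.piFinSuccAbove_symm_apply, Fin.insertNthEquiv,
      Fin.prod_univ_succ, Fin.insertNth_zero]
    simp only [Equiv.coe_fn_mk, Fin.cons_zero, Fin.cons_succ, cast_eq]
    rw [lintegral_prod_mul (g := fun y : Fin m → X => ∏ i, g i.succ (y i)) (hg 0).aemeasurable
      (Finset.univ.measurable_fun_prod fun i _ =>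
        (hg i.succ).comp (measurable_pi_apply i)).aemeasurable,
      lintegral_fin_prod_eq_prod μ fun i => hg i.succ]

theorem lintegral_fin_prod_eq_prod₀ {X : Type*} [MeasurableSpace X] (μ : Measure X)
    [SigmaFinite μ] {m : ℕ} {g : Fin m → X → ℝ≥0∞} (hg : ∀ i, AEMeasurable (g i) μ) :
    ∫⁻ y : Fin m → X, ∏ i, g i (y i) ∂(Measure.pi fun _ => μ) = ∏ i, ∫⁻ z, g i z ∂μ := by
  have h1 : ∀ᵐ y ∂(Measure.pi fun _ : Fin m => μ), ∀ i, g i (y i) = (hg i).mk (g i) (y i) :=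
    ae_all_iff.2 fun i =>
      (Measure.quasiMeasurePreserving_eval (fun _ : Fin m => μ) i).ae (hg i).ae_eq_mk
  rw [lintegral_congr_ae (h1.mono fun y hy => Finset.prod_congr rfl fun i _ => hy i),
    lintegral_fin_prod_eq_prod μ fun i => (hg i).measurable_mk]
  exact Finset.prod_congr rfl fun i _ => lintegral_congr_ae (hg i).ae_eq_mk.symm

/-- On $(2s,4s]$, of length $2s$, the integrand is at least $(4s)^{-k-1}$, and
$2s(4s)^{-k-1}=s^{-k}/(2\cdot4^k)$. -/
theorem inv_pow_le_lintegral {s : ℝ} (hs : 0 < s) (k : ℕ) :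
    (ENNReal.ofReal s ^ k)⁻¹ ≤
      (2 * 4 ^ k : ℝ≥0) * ∫⁻ t in Set.Ioi (2 * s), (ENNReal.ofReal t ^ (k + 1))⁻¹ := by
  have h1 : ENNReal.ofReal (2 * s) * (ENNReal.ofReal (4 * s) ^ (k + 1))⁻¹ ≤
      ∫⁻ t in Set.Ioi (2 * s), (ENNReal.ofReal t ^ (k + 1))⁻¹ := by
    calc _ = ∫⁻ t in Set.Ioc (2 * s) (4 * s), (ENNReal.ofReal (4 * s) ^ (k + 1))⁻¹ := by
          rw [setLIntegral_const, Real.volume_Ioc, mul_comm]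
          congr 2
          ring
      _ ≤ ∫⁻ t in Set.Ioc (2 * s) (4 * s), (ENNReal.ofReal t ^ (k + 1))⁻¹ := by
          refine setLIntegral_mono' measurableSet_Ioc fun t ht => ?_
          gcongr
          exact ht.2
      _ ≤ _ := lintegral_mono_set Set.Ioc_subset_Ioi_self
  refine le_trans (le_of_eq ?_) (mul_le_mul_right h1 _)
  have e1 : ((2 * 4 ^ k : ℝ≥0) : ℝ≥0∞) = ENNReal.ofReal (2 * 4 ^ k) := by
    rw [← ENNReal.ofReal_coe_nnreal]
    push_cast
    rfl
  rw [e1, ← ENNReal.ofReal_pow hs.le, ← ENNReal.ofReal_pow (by positivity),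
    ← ENNReal.ofReal_inv_of_pos (by positivity), ← ENNReal.ofReal_inv_of_pos (by positivity),
    ← ENNReal.ofReal_mul (by positivity), ← ENNReal.ofReal_mul (by positivity)]
  congr 1
  rw [pow_succ, mul_pow]
  field_simp
  norm_num

/-- The multilinear integral over tuples of points of which one lies outside of a ball is
controlled by the averages over the larger concentric balls. -/
theorem lintegral_prod_div_le {n m : ℕ} (k : ℕ) {h : Fin m → Rn n → ℝ≥0∞}
    (hh : ∀ i, AEMeasurable (h i) volume) {x₀ x : Rn n} {r : ℝ} (hr : 0 < r)
    (hx : x ∈ Metric.ball x₀ r) {j : Fin m} (hj : ∀ y ∈ Metric.ball x₀ (2 * r), h j y = 0) :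
    ∫⁻ y : Fin m → Rn n, (∏ i, h i (y i)) / (∑ i, edist x (y i)) ^ k ≤
      (2 * 4 ^ k : ℝ≥0) * ∫⁻ t in Set.Ioi r,
        (∏ i, ∫⁻ z in Metric.ball x₀ t, h i z) * (ENNReal.ofReal t ^ (k + 1))⁻¹ := by
  have hpt : ∀ y : Fin m → Rn n, (∏ i, h i (y i)) / (∑ i, edist x (y i)) ^ k ≤
      (2 * 4 ^ k : ℝ≥0) * ∫⁻ t in Set.Ioi r,
        (∏ i, (Metric.ball x₀ t).indicator (h i) (y i)) * (ENNReal.ofReal t ^ (k + 1))⁻¹ := by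
    intro y
    by_cases hy : y j ∈ Metric.ball x₀ (2 * r)
    · rw [Finset.prod_eq_zero (Finset.mem_univ j) (hj _ hy)]
      simp
    set s := ∑ i, dist x (y i) with hs
    have hle : ∀ i, dist x (y i) ≤ s := fun i =>
      Finset.single_le_sum (f := fun i => dist x (y i)) (fun i _ => dist_nonneg)
        (Finset.mem_univ i)
    rw [Metric.mem_ball, not_lt] at hy
    rw [Metric.mem_ball] at hx
    -- The point `y j` is at distance at least $2r$ from $x_0$, and `x` is within $r$ of it.
    have hrs : r ≤ s := by
      have := dist_triangle_left (y j) x₀ x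
      linarith [hle j]
    have hs0 : 0 < s := hr.trans_le hrs
    have he : ∑ i, edist x (y i) = ENNReal.ofReal s := by
      rw [hs, ENNReal.ofReal_sum_of_nonneg fun i _ => dist_nonneg]
      exact Finset.sum_congr rfl fun i _ => edist_dist _ _
    rw [he, div_eq_mul_inv]
    calc _ ≤ (∏ i, h i (y i)) * ((2 * 4 ^ k : ℝ≥0) *
          ∫⁻ t in Set.Ioi (2 * s), (ENNReal.ofReal t ^ (k + 1))⁻¹) := by
          gcongr
          exact inv_pow_le_lintegral hs0 k
      _ = (2 * 4 ^ k : ℝ≥0) * ((∏ i, h i (y i)) *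
          ∫⁻ t in Set.Ioi (2 * s), (ENNReal.ofReal t ^ (k + 1))⁻¹) := by ring
      _ ≤ (2 * 4 ^ k : ℝ≥0) * ∫⁻ t in Set.Ioi (2 * s),
          (∏ i, h i (y i)) * (ENNReal.ofReal t ^ (k + 1))⁻¹ := by
          gcongr
          exact lintegral_const_mul_le _ _
      _ ≤ (2 * 4 ^ k : ℝ≥0) * ∫⁻ t in Set.Ioi (2 * s),
          (∏ i, (Metric.ball x₀ t).indicator (h i) (y i)) * (ENNReal.ofReal t ^ (k + 1))⁻¹ := by
          refine mul_le_mul_right (setLIntegral_mono' measurableSet_Ioi fun t ht => ?_) _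
          apply le_of_eq
          congr 1
          refine Finset.prod_congr rfl fun i _ => ?_
          -- For $t>2s$ the indicators are free of charge: $|y_i-x_0|<r+s\le2s<t$ for every `i`.
          rw [Set.indicator_of_mem]
          rw [Metric.mem_ball]
          have := dist_triangle_left (y i) x₀ x
          have ht' : 2 * s < t := ht
          linarith [hle i]
      _ ≤ _ := by
          refine mul_le_mul_right (lintegral_mono_set (Set.Ioi_subset_Ioi ?_)) _
          linarith
  refine (lintegral_mono hpt).trans ?_
  rw [lintegral_const_mul' _ _ ENNReal.coe_ne_top]
  refine mul_le_mul_right ?_ _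
  have hev := fun i : Fin m =>
    Measure.quasiMeasurePreserving_eval (fun _ : Fin m => (volume : Measure (Rn n))) i
  -- After the swap, for fixed `t`, the integrand is a product of functions of the single variables,
  -- so the inner integral factors.
  rw [lintegral_lintegral_swap]
  · refine lintegral_mono fun t => ?_
    have hm : AEMeasurable (fun y : Fin m → Rn n =>
        ∏ i, (Metric.ball x₀ t).indicator (h i) (y i)) volume :=
      Finset.univ.aemeasurable_fun_prod fun i _ =>
        ((hh i).indicator measurableSet_ball).comp_quasiMeasurePreserving (hev i)
    rw [lintegral_mul_const'' _ hm, volume_pi, lintegral_fin_prod_eq_prod₀ volume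
        fun i => (hh i).indicator measurableSet_ball]
    simp_rw [lintegral_indicator measurableSet_ball]
    exact le_rfl
  · refine AEMeasurable.mul (Finset.univ.aemeasurable_fun_prod fun i _ => ?_)
      (by fun_prop)
    have hs : MeasurableSet {q : (Fin m → Rn n) × ℝ | dist (q.1 i) x₀ < q.2} :=
      measurableSet_lt (by fun_prop) (by fun_prop)
    exact ((hh i).comp_quasiMeasurePreserving
      ((hev i).comp Measure.quasiMeasurePreserving_fst)).indicator hs

/-! ### Morrey spaces -/

theorem wLpNorm_mono_set {n : ℕ} {𝕜 : Type*} [RCLike 𝕜] {p : ℝ} (hp : 0 < p) (ω : Rn n → ℝ)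
    {s t : Set (Rn n)} (hst : s ⊆ t) (f : Rn n → 𝕜) : wLpNorm p ω s f ≤ wLpNorm p ω t f :=
  ENNReal.rpow_le_rpow (lintegral_mono_set hst) (one_div_pos.2 hp).le

theorem le_morreyNorm {n : ℕ} {𝕜 : Type*} [RCLike 𝕜] (p : ℝ) (φ : Rn n → ℝ → ℝ) (ω : Rn n → ℝ)
    (f : Rn n → 𝕜) (x : Rn n) {r : ℝ} (hr : 0 < r) :
    (ENNReal.ofReal (φ x r))⁻¹ * wMeas ω (Metric.ball x r) ^ (-(1 / p)) *
      wLpNorm p ω (Metric.ball x r) f ≤ morreyNorm p φ ω f :=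
  le_iSup_of_le x (le_iSup_of_le r (le_iSup_of_le hr le_rfl))

theorem wLpNorm_le_morreyNorm_mul {n : ℕ} {𝕜 : Type*} [RCLike 𝕜] {p : ℝ}
    {φ : Rn n → ℝ → ℝ} (hφ : IsMorreyFunction φ) {ω : Rn n → ℝ} (hω : IsWeight ω)
    (f : Rn n → 𝕜) (x : Rn n) {r : ℝ} (hr : 0 < r) :
    wLpNorm p ω (Metric.ball x r) f ≤ morreyNorm p φ ω f *
      (ENNReal.ofReal (φ x r) * wMeas ω (Metric.ball x r) ^ (1 / p)) := by
  have h1 : ENNReal.ofReal (φ x r) ≠ 0 := by simpa using hφ.pos x r hr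
  have h2 : wMeas ω (Metric.ball x r) ^ (1 / p) ≠ 0 := by
    simp [ENNReal.rpow_eq_zero_iff, hω.wMeas_ball_ne_zero x hr, hω.wMeas_ball_ne_top x r]
  have h3 : wMeas ω (Metric.ball x r) ^ (1 / p) ≠ ∞ := by
    simp [ENNReal.rpow_eq_top_iff, hω.wMeas_ball_ne_zero x hr, hω.wMeas_ball_ne_top x r]
  have h := le_morreyNorm p φ ω f x hr
  rw [ENNReal.rpow_neg, ← ENNReal.mul_inv (Or.inl h1) (Or.inl ENNReal.ofReal_ne_top),
    ENNReal.inv_mul_le_iff (mul_ne_zero h1 h2) (ENNReal.mul_ne_top ENNReal.ofReal_ne_top h3)] at h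
  rwa [mul_comm]

theorem morreyNorm_mono {n : ℕ} {𝕜 : Type*} [RCLike 𝕜] {p : ℝ} (hp : 0 < p) (φ : Rn n → ℝ → ℝ)
    (ω : Rn n → ℝ) {f g : Rn n → 𝕜} (h : ∀ y, ‖f y‖ₑ ≤ ‖g y‖ₑ) :
    morreyNorm p φ ω f ≤ morreyNorm p φ ω g := by
  refine iSup_mono fun x => iSup_mono fun r => iSup_mono fun _ => mul_le_mul_right ?_ _
  refine ENNReal.rpow_le_rpow (lintegral_mono fun y => ?_) (one_div_pos.2 hp).le
  exact mul_le_mul_left (ENNReal.rpow_le_rpow (h y) hp.le) _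

theorem morreyNorm_smul_le {n : ℕ} {𝕜 : Type*} [RCLike 𝕜] {p : ℝ} (hp : 0 < p)
    (φ : Rn n → ℝ → ℝ) (ω : Rn n → ℝ) (c : 𝕜) (f : Rn n → 𝕜) :
    morreyNorm p φ ω (c • f) ≤ ‖c‖ₑ * morreyNorm p φ ω f := by
  refine iSup_le fun x => iSup_le fun r => iSup_le fun hr => ?_
  have h : wLpNorm p ω (Metric.ball x r) (c • f) = ‖c‖ₑ * wLpNorm p ω (Metric.ball x r) f := by
    simp only [wLpNorm, Pi.smul_apply, enorm_smul]
    simp_rw [ENNReal.mul_rpow_of_nonneg _ _ hp.le, mul_assoc]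
    rw [lintegral_const_mul' _ _ (ENNReal.rpow_ne_top_of_nonneg hp.le enorm_ne_top),
      ENNReal.mul_rpow_of_nonneg _ _ (one_div_pos.2 hp).le, ← ENNReal.rpow_mul,
      mul_one_div_cancel hp.ne', ENNReal.rpow_one]
  rw [h, mul_left_comm]
  exact mul_le_mul_right (le_morreyNorm p φ ω f x hr) _

theorem smul_mem_morreySpace {n : ℕ} {𝕜 : Type*} [RCLike 𝕜] {p : ℝ} (hp : 0 < p)
    {φ : Rn n → ℝ → ℝ} {ω : Rn n → ℝ} {f : Rn n → 𝕜} (hf : f ∈ morreySpace 𝕜 p φ ω) (c : 𝕜) :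
    c • f ∈ morreySpace 𝕜 p φ ω :=
  ⟨hf.1.const_smul c, (morreyNorm_smul_le hp φ ω c f).trans_lt
    (ENNReal.mul_lt_top enorm_lt_top hf.2)⟩

theorem indicator_mem_morreySpace {n : ℕ} {𝕜 : Type*} [RCLike 𝕜] {p : ℝ} (hp : 0 < p)
    {φ : Rn n → ℝ → ℝ} {ω : Rn n → ℝ} {f : Rn n → 𝕜} (hf : f ∈ morreySpace 𝕜 p φ ω)
    {s : Set (Rn n)} (hs : MeasurableSet s) : s.indicator f ∈ morreySpace 𝕜 p φ ω :=
  ⟨hf.1.indicator hs, (morreyNorm_mono hp φ ω (enorm_indicator_le_enorm_self f)).trans_lt hf.2⟩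

theorem mem_addMulSpace {n : ℕ} {𝕜 : Type*} [RCLike 𝕜] {p : ℝ} (hp : 0 < p)
    {φ : Rn n → ℝ → ℝ} {ω : Rn n → ℝ} {f : Rn n → 𝕜} (hf : f ∈ morreySpace 𝕜 p φ ω)
    (b : Rn n → 𝕜) : f ∈ addMulSpace b (morreySpace 𝕜 p φ ω) :=
  ⟨f, hf, (0 : 𝕜) • f, smul_mem_morreySpace hp hf 0, by simp⟩

theorem sub_mul_mem_addMulSpace {n : ℕ} {𝕜 : Type*} [RCLike 𝕜] {p : ℝ} (hp : 0 < p)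
    {φ : Rn n → ℝ → ℝ} {ω : Rn n → ℝ} {f : Rn n → 𝕜} (hf : f ∈ morreySpace 𝕜 p φ ω)
    (b : Rn n → 𝕜) (c : 𝕜) :
    (fun y => (c - b y) * f y) ∈ addMulSpace b (morreySpace 𝕜 p φ ω) :=
  ⟨c • f, smul_mem_morreySpace hp hf c, (-1 : 𝕜) • f, smul_mem_morreySpace hp hf (-1), by
    ext y
    simp only [Pi.smul_apply, smul_eq_mul]
    ring⟩

/-! ### The off-diagonal estimate -/

/-- The point `x` is fixed before `h`, since the commutators apply `T` to functions that depend on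
`x`. The domination of `h i` by $(1+|b_i(x)-b_i|)|f_i|$ covers slots with and without the factor
$b_i(x)-b_i$, hence both commutators. -/
theorem exists_enorm_offDiagonal_le {𝕜 : Type*} [RCLike 𝕜] {n m : ℕ} (hm : 0 < m)
    {P : Fin m → ℝ} (hP : ∀ k, 1 < P k) {p : ℝ} (hp : 1 / p = ∑ k, 1 / P k)
    {ω : Fin m → Rn n → ℝ} (hω : IsMultipleWeight P p ω) (hω' : ∀ i, IsAInfty (ω i))
    {φ₁ : Fin m → Rn n → ℝ → ℝ} (hφ₁ : ∀ i, IsMorreyFunction (φ₁ i))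
    {φ₂ : Rn n → ℝ → ℝ} (hφ₂ : IsMorreyFunction φ₂) (hφ : morreyPairConst P ω φ₁ φ₂ < ∞)
    {b : Fin m → Rn n → 𝕜} (hb : ∀ i, IsBMO (b i)) {T : (Fin m → Rn n → 𝕜) → Rn n → 𝕜}
    (hsize : HasSizeBound (fun i => addMulSpace (b i) (morreySpace 𝕜 (P i) (φ₁ i) (ω i))) T) :
    ∃ C : ℝ≥0, ∀ (x₀ : Rn n) (r : ℝ), 0 < r → ∀ f : Fin m → Rn n → 𝕜,
      (∀ i, f i ∈ morreySpace 𝕜 (P i) (φ₁ i) (ω i)) → ∀ x ∈ Metric.ball x₀ r,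
      ∀ h : Fin m → Rn n → 𝕜,
      (∀ i, h i ∈ addMulSpace (b i) (morreySpace 𝕜 (P i) (φ₁ i) (ω i))) →
      (∀ i y, ‖h i y‖ₑ ≤ (1 + ‖b i x - b i y‖ₑ) * ‖f i y‖ₑ) →
      ∀ j, (∀ y ∈ Metric.ball x₀ (2 * r), h j y = 0) →
      ‖T h x‖ₑ ≤ C * (ENNReal.ofReal (φ₂ x₀ r) *
        (∏ i, (1 + ‖b i x - ⨍ z in Metric.ball x₀ r, b i z‖ₑ)) *
          ∏ i, morreyNorm (P i) (φ₁ i) (ω i) (f i)) := by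
  obtain ⟨CT, hCT⟩ := hsize
  choose Cb hCb using fun i => exists_lintegral_oscillation_mul_le (hP i) (hω.1 i)
    (hω.isAInftyMeasure hm hP hp i) (hb i)
  obtain ⟨CW, hCW⟩ := hω.exists_prod_wMeas_mul_le hm hP hp hω'
  set v₀ : ℝ≥0 := (volume (Metric.ball (0 : Rn n) 1)).toNNReal with hv₀
  set Cφ : ℝ≥0 := (morreyPairConst P ω φ₁ φ₂).toNNReal with hCφ
  refine ⟨CT * (2 * 4 ^ (m * n)) * ((∏ i, Cb i) * CW * v₀ ^ m) * Cφ,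
    fun x₀ r hr f hf x hx h hh hhf j hj => ?_⟩
  -- The slot `h j` vanishes on an open ball, so its closed support misses that ball, which contains
  -- `x`.
  have hx2 : x ∉ ⋂ j, tsupport (h j) := by
    intro hx2
    have h1 : tsupport (h j) ⊆ (Metric.ball x₀ (2 * r))ᶜ := by
      refine closure_minimal ?_ Metric.isOpen_ball.isClosed_compl
      intro y hy hy'
      exact hy (hj y hy')
    exact h1 (Set.mem_iInter.1 hx2 j) (Metric.ball_subset_ball (by linarith) hx)
  have hhm : ∀ i, AEMeasurable (fun y => ‖h i y‖ₑ) volume := by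
    intro i
    obtain ⟨g, hg, g', hg', he⟩ := hh i
    rw [he]
    exact (hg.1.add ((hb i).1.aestronglyMeasurable.mul hg'.1)).enorm
  set U : Fin m → ℝ≥0∞ := fun i => 1 + ‖b i x - ⨍ z in Metric.ball x₀ r, b i z‖ₑ with hU
  set N : Fin m → ℝ≥0∞ := fun i => morreyNorm (P i) (φ₁ i) (ω i) (f i) with hN
  set E : ℝ → ℝ≥0∞ := fun t => essInf (fun η : ℝ => ∏ i, (ENNReal.ofReal (φ₁ i x₀ η) *
    wMeas (ω i) (Metric.ball x₀ η) ^ (1 / P i))) (volume.restrict (Set.Ioi t)) with hE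
  set W : ℝ → ℝ≥0∞ := fun t => ∏ i, wMeas (ω i) (Metric.ball x₀ t) ^ (1 / P i) with hW
  -- The local norm on $B(x_0,t)$ is at most that on $B(x_0,\eta)$ for every $\eta>t$, so the Morrey
  -- bound at radius $\eta$ may be minimised over $\eta$. The essential infimum is reached by
  -- dividing by $\prod N_i$, hence the separate case of product zero.
  have hL : ∀ t, 0 < t → ∏ i, wLpNorm (P i) (ω i) (Metric.ball x₀ t) (f i) ≤
      (∏ i, N i) * E t := by
    intro t ht
    have h1 : ∀ η, t < η → ∏ i, wLpNorm (P i) (ω i) (Metric.ball x₀ t) (f i) ≤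
        (∏ i, N i) * ∏ i, (ENNReal.ofReal (φ₁ i x₀ η) *
          wMeas (ω i) (Metric.ball x₀ η) ^ (1 / P i)) := by
      intro η hη
      rw [← Finset.prod_mul_distrib]
      refine Finset.prod_le_prod' fun i _ => ?_
      exact (wLpNorm_mono_set (by linarith [hP i]) _ (Metric.ball_subset_ball hη.le) _).trans
        (wLpNorm_le_morreyNorm_mul (hφ₁ i) (hω.1 i) _ _ (ht.trans hη))
    rcases eq_or_ne (∏ i, N i) 0 with h0 | h0
    · have := h1 (t + 1) (by linarith)
      rw [h0, zero_mul] at this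
      exact this.trans zero_le
    · have htop : ∏ i, N i ≠ ∞ := ENNReal.prod_ne_top fun i _ => (hf i).2.ne
      rw [mul_comm, ← ENNReal.div_le_iff_le_mul (Or.inl h0) (Or.inl htop)]
      refine le_essInf_of_ae_le _ ?_
      filter_upwards [ae_restrict_mem measurableSet_Ioi] with η hη
      rw [ENNReal.div_le_iff_le_mul (Or.inl h0) (Or.inl htop), mul_comm]
      exact h1 η hη
  have hmain : ∀ t ∈ Set.Ioi r, (∏ i, ∫⁻ z in Metric.ball x₀ t, ‖h i z‖ₑ) *
      (ENNReal.ofReal t ^ (m * n + 1))⁻¹ ≤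
      ((∏ i, Cb i) * CW * v₀ ^ m : ℝ≥0) * ((∏ i, U i) * ∏ i, N i) *
        (ENNReal.ofReal (1 + Real.log (t / r)) ^ m * (E t / W t) / ENNReal.ofReal t) := by
    intro t ht
    have ht' : r < t := ht
    have ht0 : 0 < t := hr.trans ht
    set τ := ENNReal.ofReal t with hτ
    have hτ0 : τ ≠ 0 := by simpa [hτ] using ht0
    have hτ1 : τ ≠ ∞ := ENNReal.ofReal_ne_top
    set ℓ := ENNReal.ofReal (1 + Real.log (t / r)) with hℓ
    set Sg : Fin m → ℝ≥0∞ := fun i => (∫⁻ y in Metric.ball x₀ t,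
      ENNReal.ofReal (ω i y) ^ (1 - (P i).conjExponent)) ^ (1 / (P i).conjExponent) with hSg
    have hW0 : W t ≠ 0 := Finset.prod_ne_zero_iff.2 fun i _ => by
      simp [ENNReal.rpow_eq_zero_iff, (hω.1 i).wMeas_ball_ne_zero x₀ ht0,
        (hω.1 i).wMeas_ball_ne_top x₀ t]
    have hW1 : W t ≠ ∞ := ENNReal.prod_ne_top fun i _ => by
      simp [ENNReal.rpow_eq_top_iff, (hω.1 i).wMeas_ball_ne_zero x₀ ht0,
        (hω.1 i).wMeas_ball_ne_top x₀ t]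
    -- The factor $t^{mn}$ of $|B_t|^m$ cancels against $t^{-mn-1}$ and leaves $1/t$.
    have hSgW : ∏ i, Sg i ≤ CW * (τ ^ (m * n) * v₀ ^ m) / W t := by
      rw [ENNReal.le_div_iff_mul_le (Or.inl hW0) (Or.inl hW1), mul_comm]
      refine (hCW x₀ t ht0).trans (le_of_eq ?_)
      rw [volume_ball_eq x₀ ht0, hv₀, ENNReal.coe_toNNReal measure_ball_lt_top.ne, mul_pow,
        ← pow_mul, mul_comm n m]
    have h1 : ∀ i, ∫⁻ z in Metric.ball x₀ t, ‖h i z‖ₑ ≤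
        Cb i * (U i * ℓ * wLpNorm (P i) (ω i) (Metric.ball x₀ t) (f i) * Sg i) := by
      intro i
      refine le_trans (lintegral_mono fun y => ?_)
        (hCb i x₀ r t hr ht'.le (U i) le_self_add (f i) (hf i).1)
      refine (hhf i y).trans (mul_le_mul_left ?_ _)
      rw [hU]
      simp only
      rw [add_assoc]
      refine add_le_add_right ?_ _
      rw [← sub_sub_sub_cancel_right _ _ (⨍ z in Metric.ball x₀ r, b i z)]
      exact enorm_sub_le
    have hτinv : τ ^ (m * n) * (τ ^ (m * n + 1))⁻¹ = τ⁻¹ := by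
      rw [pow_succ, ENNReal.mul_inv (Or.inl (pow_ne_zero _ hτ0))
        (Or.inl (ENNReal.pow_ne_top hτ1)), ← mul_assoc,
        ENNReal.mul_inv_cancel (pow_ne_zero _ hτ0) (ENNReal.pow_ne_top hτ1), one_mul]
    calc _ ≤ (∏ i, (Cb i * (U i * ℓ * wLpNorm (P i) (ω i) (Metric.ball x₀ t) (f i) * Sg i))) *
          (τ ^ (m * n + 1))⁻¹ := mul_le_mul_left (Finset.prod_le_prod' fun i _ => h1 i) _
      _ = (∏ i, (Cb i : ℝ≥0∞)) * ((∏ i, U i) * ℓ ^ m *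
          (∏ i, wLpNorm (P i) (ω i) (Metric.ball x₀ t) (f i)) * ∏ i, Sg i) *
          (τ ^ (m * n + 1))⁻¹ := by
          simp only [Finset.prod_mul_distrib, Finset.prod_const, Finset.card_univ,
            Fintype.card_fin]
      _ ≤ (∏ i, (Cb i : ℝ≥0∞)) * ((∏ i, U i) * ℓ ^ m *
          ((∏ i, N i) * E t) * (CW * (τ ^ (m * n) * v₀ ^ m) / W t)) *
          (τ ^ (m * n + 1))⁻¹ := by
          gcongr
          exact hL t ht0
      _ = (∏ i, (Cb i : ℝ≥0∞)) * ((∏ i, U i) * ℓ ^ m *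
          ((∏ i, N i) * E t) * (CW * v₀ ^ m * (W t)⁻¹)) *
          (τ ^ (m * n) * (τ ^ (m * n + 1))⁻¹) := by
          rw [div_eq_mul_inv]
          ring
      _ = _ := by
          rw [hτinv, div_eq_mul_inv, div_eq_mul_inv]
          push_cast
          ring
  have hK : ((∏ i, Cb i) * CW * v₀ ^ m : ℝ≥0) * ((∏ i, U i) * ∏ i, N i) ≠ ∞ := by
    refine ENNReal.mul_ne_top ENNReal.coe_ne_top (ENNReal.mul_ne_top ?_ ?_)
    · exact ENNReal.prod_ne_top fun i _ => by simp [hU]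
    · exact ENNReal.prod_ne_top fun i _ => (hf i).2.ne
  have hint : ∫⁻ t in Set.Ioi r,
      ENNReal.ofReal (1 + Real.log (t / r)) ^ m * (E t / W t) / ENNReal.ofReal t ≤
      ENNReal.ofReal (φ₂ x₀ r) * Cφ := by
    have h1 : (ENNReal.ofReal (φ₂ x₀ r))⁻¹ * ∫⁻ t in Set.Ioi r,
        ENNReal.ofReal (1 + Real.log (t / r)) ^ m * (E t / W t) / ENNReal.ofReal t ≤
        morreyPairConst P ω φ₁ φ₂ := le_iSup_of_le x₀ (le_iSup_of_le r (le_iSup_of_le hr le_rfl))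
    rw [ENNReal.inv_mul_le_iff (by simpa using hφ₂.pos x₀ r hr) ENNReal.ofReal_ne_top] at h1
    rwa [hCφ, ENNReal.coe_toNNReal hφ.ne]
  calc ‖T h x‖ₑ ≤ CT * ∫⁻ y : Fin m → Rn n,
        (∏ i, ‖h i (y i)‖ₑ) / (∑ j, edist x (y j)) ^ (m * n) := hCT h hh x hx2
    _ ≤ CT * ((2 * 4 ^ (m * n) : ℝ≥0) * ∫⁻ t in Set.Ioi r,
        (∏ i, ∫⁻ z in Metric.ball x₀ t, ‖h i z‖ₑ) * (ENNReal.ofReal t ^ (m * n + 1))⁻¹) :=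
        mul_le_mul_right (lintegral_prod_div_le (m * n) hhm hr hx
          (fun y hy => by rw [hj y hy, enorm_zero])) _
    _ ≤ CT * ((2 * 4 ^ (m * n) : ℝ≥0) * ∫⁻ t in Set.Ioi r,
        ((∏ i, Cb i) * CW * v₀ ^ m : ℝ≥0) * ((∏ i, U i) * ∏ i, N i) *
          (ENNReal.ofReal (1 + Real.log (t / r)) ^ m * (E t / W t) / ENNReal.ofReal t)) :=
        mul_le_mul_right (mul_le_mul_right (setLIntegral_mono' measurableSet_Ioi hmain) _) _
    _ ≤ CT * ((2 * 4 ^ (m * n) : ℝ≥0) * (((∏ i, Cb i) * CW * v₀ ^ m : ℝ≥0) *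
        ((∏ i, U i) * ∏ i, N i) * (ENNReal.ofReal (φ₂ x₀ r) * Cφ))) := by
        rw [lintegral_const_mul' _ _ hK]
        gcongr
    _ = _ := by
        push_cast
        ring

/-! ### From local to global bounds -/

theorem enorm_le_add_of_norm_le {E : Type*} [SeminormedAddCommGroup E] {u v w : E}
    (h : ‖u‖ ≤ ‖v‖ + ‖w‖) : ‖u‖ₑ ≤ ‖v‖ₑ + ‖w‖ₑ := by
  rw [← ofReal_norm, ← ofReal_norm, ← ofReal_norm,
    ← ENNReal.ofReal_add (norm_nonneg _) (norm_nonneg _)]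
  exact ENNReal.ofReal_le_ofReal h

/-- Localisation of the slots of an `m`-sublinear operator one after the other. -/
theorem enorm_le_enorm_indicator_add {n m : ℕ} {𝕜 : Type*} [RCLike 𝕜] {P : Fin m → ℝ}
    (hP : ∀ i, 0 < P i) {φ₁ : Fin m → Rn n → ℝ → ℝ} {ω : Fin m → Rn n → ℝ}
    {S : (Fin m → Rn n → 𝕜) → Rn n → 𝕜}
    (hS : IsMSublinear (fun i => morreySpace 𝕜 (P i) (φ₁ i) (ω i)) S) {f : Fin m → Rn n → 𝕜}
    (hf : ∀ i, f i ∈ morreySpace 𝕜 (P i) (φ₁ i) (ω i)) {B : Set (Rn n)} (hB : MeasurableSet B)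
    {x : Rn n} {K : ℝ≥0∞}
    (hK : ∀ g : Fin m → Rn n → 𝕜, (∀ i, g i ∈ morreySpace 𝕜 (P i) (φ₁ i) (ω i)) →
      (∀ i y, ‖g i y‖ₑ ≤ ‖f i y‖ₑ) → ∀ j, (∀ y ∈ B, g j y = 0) → ‖S g x‖ₑ ≤ K) :
    ‖S f x‖ₑ ≤ ‖S (fun i => B.indicator (f i)) x‖ₑ + m * K := by
  classical
  set f₀ : Fin m → Rn n → 𝕜 := fun i => B.indicator (f i) with hf₀
  have hmem₀ : ∀ i, f₀ i ∈ morreySpace 𝕜 (P i) (φ₁ i) (ω i) := fun i =>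
    indicator_mem_morreySpace (hP i) (hf i) hB
  have hle₀ : ∀ i y, ‖f₀ i y‖ₑ ≤ ‖f i y‖ₑ := fun i y => enorm_indicator_le_enorm_self (f i) y
  -- `s` is the set of slots already cut off to `B`. Cutting off one more slot `a` leaves a
  -- remainder whose slot `a` vanishes on `B`; all its slots stay dominated by those of `f`, so the
  -- same `K` bounds it.
  have key : ∀ s : Finset (Fin m), ‖S f x‖ₑ ≤ ‖S (s.piecewise f₀ f) x‖ₑ + s.card * K := by
    intro s
    induction s using Finset.induction with
    | empty => simp
    | insert a s ha ih =>
      set h := s.piecewise f₀ f with hh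
      have hmem : ∀ i, h i ∈ morreySpace 𝕜 (P i) (φ₁ i) (ω i) := fun i => by
        by_cases hi : i ∈ s
        · rw [hh, Finset.piecewise_eq_of_mem _ _ _ hi]
          exact hmem₀ i
        · rw [hh, Finset.piecewise_eq_of_notMem _ _ _ hi]
          exact hf i
      have hle : ∀ i y, ‖h i y‖ₑ ≤ ‖f i y‖ₑ := fun i y => by
        by_cases hi : i ∈ s
        · rw [hh, Finset.piecewise_eq_of_mem _ _ _ hi]
          exact hle₀ i y
        · rw [hh, Finset.piecewise_eq_of_notMem _ _ _ hi]
      set f₁ := Bᶜ.indicator (f a) with hf₁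
      have hmem₁ : f₁ ∈ morreySpace 𝕜 (P a) (φ₁ a) (ω a) :=
        indicator_mem_morreySpace (hP a) (hf a) hB.compl
      have hupd : ∀ g, g ∈ morreySpace 𝕜 (P a) (φ₁ a) (ω a) →
          ∀ i, Function.update h a g i ∈ morreySpace 𝕜 (P i) (φ₁ i) (ω i) := by
        intro g hg i
        rcases eq_or_ne i a with rfl | hi
        · rwa [Function.update_self]
        · rw [Function.update_of_ne hi]
          exact hmem i
      have h1 := enorm_le_add_of_norm_le
        (hS.add_le (Function.update h a (f₀ a)) (hupd _ (hmem₀ a)) a f₁ hmem₁ x)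
      rw [Function.update_self, Function.update_idem, Function.update_idem] at h1
      have h2 : Function.update h a (f₀ a + f₁) = h := by
        have : f₀ a + f₁ = h a := by
          rw [hh, Finset.piecewise_eq_of_notMem _ _ _ ha]
          exact Set.indicator_self_add_compl B (f a)
        rw [this, Function.update_eq_self]
      have h3 : ‖S (Function.update h a f₁) x‖ₑ ≤ K := by
        refine hK _ (hupd _ hmem₁) (fun i y => ?_) a fun y hy => ?_
        · rcases eq_or_ne i a with rfl | hi
          · rw [Function.update_self]
            exact enorm_indicator_le_enorm_self (f i) y
          · rw [Function.update_of_ne hi]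
            exact hle i y
        · rw [Function.update_self, hf₁]
          simp [hy]
      rw [h2] at h1
      rw [Finset.piecewise_insert, Finset.card_insert_of_notMem ha]
      calc _ ≤ _ := ih
        _ ≤ (‖S (Function.update h a (f₀ a)) x‖ₑ + K) + s.card * K := by
          gcongr
          exact h1.trans (by gcongr)
        _ = _ := by push_cast; ring
  have := key Finset.univ
  rwa [Finset.piecewise_univ, Finset.card_univ, Fintype.card_fin] at this

/-- Here $p$ may be less than one, so Minkowski's inequality is not available; this is used with the
exponents $p$ and $1/p$. -/
theorem add_rpow_le_two_rpow_mul {p : ℝ} (hp : 0 ≤ p) (u w : ℝ≥0∞) :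
    (u + w) ^ p ≤ 2 ^ p * (u ^ p + w ^ p) := by
  calc (u + w) ^ p ≤ (2 * max u w) ^ p := by
        refine ENNReal.rpow_le_rpow ?_ hp
        rw [two_mul]
        exact add_le_add (le_max_left _ _) (le_max_right _ _)
    _ = 2 ^ p * (max u w) ^ p := ENNReal.mul_rpow_of_nonneg _ _ hp
    _ ≤ _ := by
        gcongr
        rcases le_total u w with h | h
        · rw [max_eq_right h]; exact le_add_self
        · rw [max_eq_left h]; exact le_self_add

/-- Products of oscillations have moments with respect to weights of class `A_∞`. -/
theorem exists_lintegral_prod_rpow_le {n m : ℕ} (hm : 0 < m) {𝕜 : Type*} [RCLike 𝕜]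
    {v : Rn n → ℝ} (hv : IsAInfty v) {b : Fin m → Rn n → 𝕜} (hb : ∀ i, IsBMO (b i)) {p : ℝ}
    (hp : 0 < p) : ∃ C : ℝ≥0, ∀ (x : Rn n) (r : ℝ), 0 < r →
      ∫⁻ y in Metric.ball x r, (∏ i, (1 + ‖b i y - ⨍ z in Metric.ball x r, b i z‖ₑ)) ^ p *
        ENNReal.ofReal (v y) ≤ C * wMeas v (Metric.ball x r) := by
  have hm' : (0 : ℝ) < m := by exact_mod_cast hm
  have hσ := hv.isAInftyMeasure
  have hvm : IsWeight v := by
    obtain ⟨q, -, h⟩ := hv.exists_isMuckenhoupt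
    exact h.1
  -- Hölder with $m$ equal exponents $1/m$ calls for moments of order $pm$ of each oscillation.
  choose C hC using fun i => hσ.exists_lintegral_rpow_le (hb i) (mul_pos hp hm')
  refine ⟨∏ i, C i ^ (1 / (m : ℝ)), fun x r hr => ?_⟩
  set B := Metric.ball x r with hB
  set a : Fin m → Rn n → ℝ≥0∞ := fun i y => 1 + ‖b i y - ⨍ z in B, b i z‖ₑ with ha
  have ham : ∀ i, AEMeasurable (a i) volume := fun i => aemeasurable_const.add
    ((hb i).1.aestronglyMeasurable.sub aestronglyMeasurable_const).enorm
  have hm1 : (0 : ℝ) ≤ 1 / m := (one_div_pos.2 hm').le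
  set σ := (volume : Measure (Rn n)).withDensity fun y => ENNReal.ofReal (v y) with hσ_def
  have hσB : σ B = wMeas v B := withDensity_apply _ measurableSet_ball
  have hvol0 := hvm.wMeas_ball_ne_zero x hr
  have hvol1 := hvm.wMeas_ball_ne_top x r
  calc _ = ∫⁻ y in B, (∏ i, a i y) ^ p ∂σ := by
        rw [restrict_withDensity measurableSet_ball,
          lintegral_withDensity_eq_lintegral_mul₀ hvm.aemeasurable.restrict
            ((Finset.univ.aemeasurable_fun_prod fun i _ => ham i).pow_const _).restrict]
        exact lintegral_congr fun y => mul_comm _ _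
    _ = ∫⁻ y in B, ∏ i, (a i y ^ (p * m)) ^ (1 / (m : ℝ)) ∂σ := by
        refine lintegral_congr fun y => ?_
        rw [← ENNReal.prod_rpow_of_nonneg hp.le]
        refine Finset.prod_congr rfl fun i _ => ?_
        rw [← ENNReal.rpow_mul, mul_assoc, mul_one_div_cancel hm'.ne', mul_one]
    _ ≤ ∏ i, (∫⁻ y in B, a i y ^ (p * m) ∂σ) ^ (1 / (m : ℝ)) := by
        refine ENNReal.lintegral_prod_norm_pow_le _ (fun i _ => ?_) ?_ fun i _ => hm1
        · exact (((ham i).mono_ac hσ.absolutelyContinuous).pow_const _).restrict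
        · rw [Finset.sum_const, Finset.card_univ, Fintype.card_fin, nsmul_eq_mul,
            mul_one_div_cancel hm'.ne']
    _ ≤ ∏ i, (C i * wMeas v B) ^ (1 / (m : ℝ)) := by
        refine Finset.prod_le_prod' fun i _ => ENNReal.rpow_le_rpow ?_ hm1
        rw [← hσB]
        exact hC i x r hr
    _ = _ := by
        simp_rw [ENNReal.mul_rpow_of_nonneg _ _ hm1]
        rw [Finset.prod_mul_distrib, prod_rpow_eq_rpow_sum _ hvol0 hvol1, Finset.sum_const,
          Finset.card_univ, Fintype.card_fin, nsmul_eq_mul, mul_one_div_cancel hm'.ne',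
          ENNReal.rpow_one]
        push_cast
        congr 1
        exact Finset.prod_congr rfl fun i _ => (ENNReal.coe_rpow_of_nonneg _ hm1).symm

/-- A locally bounded operator with an off-diagonal estimate is bounded. -/
theorem MorreyLocallyBounded.morreyBounded {𝕜 : Type*} [RCLike 𝕜] {n m : ℕ} (hm : 0 < m)
    {P : Fin m → ℝ} (hP : ∀ k, 1 < P k) {p : ℝ} (hp : 0 < p) {ω : Fin m → Rn n → ℝ}
    {v : Rn n → ℝ} (hv : IsAInfty v) {φ₁ : Fin m → Rn n → ℝ → ℝ} {φ₂ : Rn n → ℝ → ℝ}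
    (hφ₂ : IsMorreyFunction φ₂) {b : Fin m → Rn n → 𝕜} (hb : ∀ i, IsBMO (b i))
    {S : (Fin m → Rn n → 𝕜) → Rn n → 𝕜} (hS : MorreyLocallyBounded P φ₁ ω p φ₂ v S) {C₁ : ℝ≥0}
    (hC₁ : ∀ (x₀ : Rn n) (r : ℝ), 0 < r → ∀ f : Fin m → Rn n → 𝕜,
      (∀ i, f i ∈ morreySpace 𝕜 (P i) (φ₁ i) (ω i)) → ∀ x ∈ Metric.ball x₀ r,
      ∀ j, (∀ y ∈ Metric.ball x₀ (2 * r), f j y = 0) →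
      ‖S f x‖ₑ ≤ C₁ * (ENNReal.ofReal (φ₂ x₀ r) *
        (∏ i, (1 + ‖b i x - ⨍ z in Metric.ball x₀ r, b i z‖ₑ)) *
          ∏ i, morreyNorm (P i) (φ₁ i) (ω i) (f i))) :
    MorreyBounded P φ₁ ω p φ₂ v S := by
  obtain ⟨hsub, C₂, hC₂⟩ := hS
  refine ⟨hsub, ?_⟩
  have hP0 : ∀ i, 0 < P i := fun i => by linarith [hP i]
  have hp1 : 0 ≤ 1 / p := (one_div_pos.2 hp).le
  have hvm : IsWeight v := by
    obtain ⟨q, -, h⟩ := hv.exists_isMuckenhoupt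
    exact h.1
  obtain ⟨C₃, hC₃⟩ := exists_lintegral_prod_rpow_le hm hv hb hp
  -- The quasi-triangle inequality with exponent $p$ gives $2^p$, whose power $1/p$ is the first
  -- factor; with exponent $1/p$ it gives the second.
  refine ⟨2 * 2 ^ (1 / p) * (C₂ + m * C₁ * C₃ ^ (1 / p)), fun f hf => ?_⟩
  set N := ∏ i, morreyNorm (P i) (φ₁ i) (ω i) (f i) with hN
  have hNtop : N ≠ ∞ := ENNReal.prod_ne_top fun i _ => (hf i).2.ne
  refine iSup_le fun x₀ => iSup_le fun r => iSup_le fun hr => ?_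
  set B := Metric.ball x₀ r with hB
  set f₀ : Fin m → Rn n → 𝕜 := fun i => (Metric.ball x₀ (2 * r)).indicator (f i) with hf₀
  set W : Rn n → ℝ≥0∞ := fun x => ∏ i, (1 + ‖b i x - ⨍ z in B, b i z‖ₑ) with hW
  set Φ := ENNReal.ofReal (φ₂ x₀ r) with hΦ
  have hΦ0 : Φ ≠ 0 := by simpa [hΦ] using hφ₂.pos x₀ r hr
  have hΦ1 : Φ ≠ ∞ := ENNReal.ofReal_ne_top
  set K : ℝ≥0∞ := m * (C₁ * (Φ * N)) with hK
  have hKtop : K ≠ ∞ := ENNReal.mul_ne_top (ENNReal.natCast_ne_top m)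
    (ENNReal.mul_ne_top ENNReal.coe_ne_top (ENNReal.mul_ne_top hΦ1 hNtop))
  have hpt : ∀ x ∈ B, ‖S f x‖ₑ ≤ ‖S f₀ x‖ₑ + K * W x := by
    intro x hx
    have h := enorm_le_enorm_indicator_add hP0 hsub hf
      (measurableSet_ball (x := x₀) (ε := 2 * r)) (x := x) (K := C₁ * (Φ * W x * N))
      fun g hg hgf j hj => (hC₁ x₀ r hr g hg x hx j hj).trans (by
        refine mul_le_mul_right (mul_le_mul_right (Finset.prod_le_prod' fun i _ => ?_) _) _
        exact morreyNorm_mono (hP0 i) _ _ (hgf i))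
    refine h.trans (le_of_eq ?_)
    rw [hK]
    ring
  have hWm : AEMeasurable W volume := Finset.univ.aemeasurable_fun_prod fun i _ =>
    aemeasurable_const.add
      ((hb i).1.aestronglyMeasurable.sub aestronglyMeasurable_const).enorm
  have hWv : AEMeasurable (fun x => K ^ p * (W x ^ p * ENNReal.ofReal (v x))) volume :=
    ((hWm.pow_const p).mul hvm.aemeasurable).const_mul _
  have hLp : wLpNorm p v B (S f) ≤ 2 * 2 ^ (1 / p) * (wLpNorm p v B (S f₀) +
      K * (C₃ ^ (1 / p) * wMeas v B ^ (1 / p))) := by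
    have h1 : ∫⁻ x in B, ‖S f x‖ₑ ^ p * ENNReal.ofReal (v x) ≤
        2 ^ p * ((∫⁻ x in B, ‖S f₀ x‖ₑ ^ p * ENNReal.ofReal (v x)) +
          K ^ p * (C₃ * wMeas v B)) := by
      calc _ ≤ ∫⁻ x in B, 2 ^ p * (‖S f₀ x‖ₑ ^ p * ENNReal.ofReal (v x) +
            K ^ p * (W x ^ p * ENNReal.ofReal (v x))) := by
            refine setLIntegral_mono' measurableSet_ball fun x hx => ?_
            calc _ ≤ (2 ^ p * (‖S f₀ x‖ₑ ^ p + (K * W x) ^ p)) * ENNReal.ofReal (v x) := by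
                  gcongr
                  exact (ENNReal.rpow_le_rpow (hpt x hx) hp.le).trans
                    (add_rpow_le_two_rpow_mul hp.le _ _)
              _ = _ := by
                  rw [ENNReal.mul_rpow_of_nonneg _ _ hp.le]
                  ring
        _ = 2 ^ p * ((∫⁻ x in B, ‖S f₀ x‖ₑ ^ p * ENNReal.ofReal (v x)) +
            K ^ p * ∫⁻ x in B, W x ^ p * ENNReal.ofReal (v x)) := by
            -- Splitting the integral uses measurability of the explicit term with `W` only, not of
            -- `S f₀`.
            rw [lintegral_const_mul' _ _ (ENNReal.rpow_ne_top_of_nonneg hp.le (by simp)),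
              lintegral_add_right' _ hWv.restrict,
              lintegral_const_mul' _ _ (ENNReal.rpow_ne_top_of_nonneg hp.le hKtop)]
        _ ≤ _ := by
            gcongr
            exact hC₃ x₀ r hr
    refine (ENNReal.rpow_le_rpow h1 hp1).trans ?_
    rw [ENNReal.mul_rpow_of_nonneg _ _ hp1, ← ENNReal.rpow_mul, mul_one_div_cancel hp.ne',
      ENNReal.rpow_one, mul_assoc]
    gcongr
    refine (add_rpow_le_two_rpow_mul hp1 _ _).trans (le_of_eq ?_)
    rw [ENNReal.mul_rpow_of_nonneg _ _ hp1, ENNReal.mul_rpow_of_nonneg _ _ hp1,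
      ← ENNReal.rpow_mul, mul_one_div_cancel hp.ne', ENNReal.rpow_one]
    rfl
  have hV : wMeas v B ^ (-(1 / p)) * wMeas v B ^ (1 / p) = 1 := by
    rw [← ENNReal.rpow_add _ _ (hvm.wMeas_ball_ne_zero x₀ hr) (hvm.wMeas_ball_ne_top x₀ r),
      neg_add_cancel, ENNReal.rpow_zero]
  have hloc : Φ⁻¹ * wMeas v B ^ (-(1 / p)) * wLpNorm p v B (S f₀) ≤ C₂ * N :=
    (le_morreyNorm p φ₂ v (S f₀) x₀ hr).trans (hC₂ x₀ r hr f hf)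
  calc Φ⁻¹ * wMeas v B ^ (-(1 / p)) * wLpNorm p v B (S f)
      ≤ Φ⁻¹ * wMeas v B ^ (-(1 / p)) * (2 * 2 ^ (1 / p) * (wLpNorm p v B (S f₀) +
        K * (C₃ ^ (1 / p) * wMeas v B ^ (1 / p)))) := by gcongr
    _ = 2 * 2 ^ (1 / p) * (Φ⁻¹ * wMeas v B ^ (-(1 / p)) * wLpNorm p v B (S f₀) +
        m * C₁ * C₃ ^ (1 / p) * N * (Φ⁻¹ * Φ) *
          (wMeas v B ^ (-(1 / p)) * wMeas v B ^ (1 / p))) := by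
        rw [hK]
        ring
    _ ≤ 2 * 2 ^ (1 / p) * (C₂ * N + m * C₁ * C₃ ^ (1 / p) * N) := by
        rw [hV, ENNReal.inv_mul_cancel hΦ0 hΦ1, mul_one, mul_one]
        gcongr
    _ = _ := by
        push_cast
        rw [ENNReal.coe_rpow_of_nonneg _ hp1, ENNReal.coe_rpow_of_nonneg _ hp1]
        push_cast
        ring

/-- A bounded operator is locally bounded. -/
theorem MorreyBounded.morreyLocallyBounded {𝕜 : Type*} [RCLike 𝕜] {n m : ℕ}
    {P : Fin m → ℝ} (hP : ∀ k, 1 < P k) {p : ℝ} {ω : Fin m → Rn n → ℝ}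
    {v : Rn n → ℝ} {φ₁ : Fin m → Rn n → ℝ → ℝ} {φ₂ : Rn n → ℝ → ℝ}
    {S : (Fin m → Rn n → 𝕜) → Rn n → 𝕜} (hS : MorreyBounded P φ₁ ω p φ₂ v S) :
    MorreyLocallyBounded P φ₁ ω p φ₂ v S := by
  have hP0 : ∀ i, 0 < P i := fun i => by linarith [hP i]
  obtain ⟨hsub, C, hC⟩ := hS
  refine ⟨hsub, C, fun x₀ r _ f hf => ?_⟩
  refine (hC _ fun i => indicator_mem_morreySpace (hP0 i) (hf i) measurableSet_ball).trans ?_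
  gcongr with i _
  exact morreyNorm_mono (hP0 i) _ _ fun y => enorm_indicator_le_enorm_self (f i) y

/-! ### The equivalences for the two commutators -/

theorem corollary1p2 {𝕜 : Type*} [RCLike 𝕜] (n m : ℕ) (hn : 0 < n) (hm : 0 < m)
    (P : Fin m → ℝ) (hP : ∀ k, 1 < P k) (p : ℝ) (hp : 1 / p = ∑ k, 1 / P k)
    (ω : Fin m → Rn n → ℝ) (hω : IsMultipleWeight P p ω) (hω' : ∀ i, IsAInfty (ω i))
    (v : Rn n → ℝ) (hv : IsAInfty v)
    (φ₁ : Fin m → Rn n → ℝ → ℝ) (hφ₁ : ∀ i, IsMorreyFunction (φ₁ i))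
    (φ₂ : Rn n → ℝ → ℝ) (hφ₂ : IsMorreyFunction φ₂)
    (hφ : morreyPairConst P ω φ₁ φ₂ < ∞)
    (b : Fin m → Rn n → 𝕜) (hb : ∀ i, IsBMO (b i))
    (T : (Fin m → Rn n → 𝕜) → Rn n → 𝕜)
    (hT : IsMSublinear (fun i => addMulSpace (b i) (morreySpace 𝕜 (P i) (φ₁ i) (ω i))) T)
    (hsize : HasSizeBound (fun i => addMulSpace (b i) (morreySpace 𝕜 (P i) (φ₁ i) (ω i))) T) :
    (MorreyLocallyBounded P φ₁ ω p φ₂ v (commProd b T) ↔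
        MorreyBounded P φ₁ ω p φ₂ v (commProd b T)) ∧
      (MorreyLocallyBounded P φ₁ ω p φ₂ v (commSum b T) ↔
        MorreyBounded P φ₁ ω p φ₂ v (commSum b T)) := by
  have hP0 : ∀ i, 0 < P i := fun i => by linarith [hP i]
  have hp0 := pos_of_one_div_eq_sum hm hP hp
  obtain ⟨C, hC⟩ := exists_enorm_offDiagonal_le hm hP hp hω hω' hφ₁ hφ₂ hφ hb hsize
  refine ⟨⟨fun hS => hS.morreyBounded (C₁ := C) hm hP hp0 hv hφ₂ hb ?_,
    fun hS => hS.morreyLocallyBounded hP⟩,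
    -- One off-diagonal estimate for each of the `m` summands of the sum commutator.
    ⟨fun hS => hS.morreyBounded (C₁ := m * C) hm hP hp0 hv hφ₂ hb ?_,
      fun hS => hS.morreyLocallyBounded hP⟩⟩
  · intro x₀ r hr f hf x hx j hj
    -- With `x` frozen, $b_i(x)$ is a constant, so $(b_i(x)-b_i)f_i$ lies in $X_i+b_iX_i$, and it
    -- vanishes wherever $f_i$ does.
    refine hC x₀ r hr f hf x hx _ (fun i => sub_mul_mem_addMulSpace (hP0 i) (hf i) _ _)
      (fun i y => ?_) j fun y hy => by rw [hj y hy, mul_zero]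
    rw [enorm_mul]
    gcongr
    exact le_add_self
  · intro x₀ r hr f hf x hx j hj
    have h1 : ∀ k, ‖T (Function.update f k fun y => (b k x - b k y) * f k y) x‖ₑ ≤
        C * (ENNReal.ofReal (φ₂ x₀ r) *
          (∏ i, (1 + ‖b i x - ⨍ z in Metric.ball x₀ r, b i z‖ₑ)) *
            ∏ i, morreyNorm (P i) (φ₁ i) (ω i) (f i)) := by
      intro k
      refine hC x₀ r hr f hf x hx _ (fun i => ?_) (fun i y => ?_) j fun y hy => ?_
      · rcases eq_or_ne i k with rfl | hi
        · rw [Function.update_self]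
          exact sub_mul_mem_addMulSpace (hP0 i) (hf i) _ _
        · rw [Function.update_of_ne hi]
          exact mem_addMulSpace (hP0 i) (hf i) _
      · rcases eq_or_ne i k with rfl | hi
        · rw [Function.update_self, enorm_mul]
          gcongr
          exact le_add_self
        · rw [Function.update_of_ne hi]
          exact le_mul_of_one_le_left' le_self_add
      · rcases eq_or_ne j k with rfl | hi
        · rw [Function.update_self, hj y hy, mul_zero]
        · rw [Function.update_of_ne hi, hj y hy]
    calc ‖commSum b T f x‖ₑ ≤
          ∑ k, ‖T (Function.update f k fun y => (b k x - b k y) * f k y) x‖ₑ :=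
          enorm_sum_le _ _
      _ ≤ ∑ _k : Fin m, C * (ENNReal.ofReal (φ₂ x₀ r) *
          (∏ i, (1 + ‖b i x - ⨍ z in Metric.ball x₀ r, b i z‖ₑ)) *
            ∏ i, morreyNorm (P i) (φ₁ i) (ω i) (f i)) := Finset.sum_le_sum fun k _ => h1 k
      _ = _ := by
          rw [Finset.sum_const, Finset.card_univ, Fintype.card_fin, nsmul_eq_mul]
          push_cast
          ring
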